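/- Let $G_{\mathbb C}$ be a connected complex Lie group whose (finite-dimensional) Lie algebra $\mathfrak g_{\mathbb C}$ is simple. Let $\mathbb O_{\min,\mathbb C}\subset\mathfrak g_{\mathbb C}^*$ be the minimal nilpotent coadjoint orbit of $G_{\mathbb C}$, that is, the coadjoint orbit that is minimal, for the closure ordering, among the nonzero nilpotent coadjoint orbits. (Here $\lambda\in\mathfrak g_{\mathbb C}^*$ is nilpotent if $\lambda=B(X,\cdot)$ with $B$ the Killing form and $\operatorname{ad}X$ nilpotent.) Every coadjoint orbit $\mathbb O$ carries the holomorphic Kirillov--Kostant--Souriau symplectic form, given on $T_\lambda\mathbb O\simeq\mathfrak g_{\mathbb C}/Z_{\mathfrak g_{\mathbb C}}(\lambda)$, where $Z_{\mathfrak g_{\mathbb C}}(\lambda)=\{Y\in\mathfrak g_{\mathbb C}:\lambda([X,Y])=0\text{ for all }X\in\mathfrak g_{\mathbb C}\}$, by $\omega_\lambda(X,Y)=\lambda([X,Y])$; a product of two coadjoint orbits carries the direct sum of the two forms. A subspace $W$ of a symplectic vector space $(V,\omega)$ is coisotropic if $W^{\perp}\subset W$, where $W^{\perp}=\{v\in V:\omega(v,w)=0\text{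 for all }w\in W\}$. The action of a complex Lie group $H$ on such a symplectic manifold $X$ is called coisotropic if there is an $H$-stable open dense subset $U$ of $X$ such that $T_x(H\cdot x)$ is a coisotropic subspace of $T_xX$ for all $x\in U$. Theorem. (1) The diagonal action of $G_{\mathbb C}$ on $\mathbb O_{\min,\mathbb C}\times\mathbb O_{\min,\mathbb C}$ is coisotropic. (2) For every complex symmetric pair $(G_{\mathbb C},K_{\mathbb C})$, i.e. for every open subgroup $K_{\mathbb C}$ of the fixed point group $G_{\mathbb C}^{\theta}$ of a holomorphic automorphism $\theta$ of $G_{\mathbb C}$ with $\theta^2=\mathrm{id}$, the coadjoint action of $K_{\mathbb C}$ on $\mathbb O_{\min,\mathbb C}$ is coisotropic. -/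

import Mathlib

open scoped Manifold ContDiff Topology

noncomputable section

namespace CoisotropicAction

/-! ### Coisotropic subspaces and coisotropic actions -/

/-- A subspace `W` of a vector space with a symplectic form `Ω` is coisotropic if `W^⊥ ⊆ W`,
where `W^⊥` is the space of all `v` such that `Ω(v, ·)` vanishes on `W`. -/
def IsCoisotropic {V : Type*} [AddCommGroup V] [Module ℂ V] (Ω : LinearMap.BilinForm ℂ V)
    (W : Submodule ℂ V) : Prop :=
  ∀ v : V, (∀ w ∈ W, Ω v w = 0) → v ∈ W

/-- Let `Γ` act (through `act`) on a subspace `M` of a topological space, where each `x ∈ M` has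
the tangent space `T x` with symplectic form `Ω x`, and let `W x ⊆ T x` be the tangent space at `x`
of the `Γ`-orbit of `x`.  The action is coisotropic if there is a `Γ`-stable open dense subset `U`
of `M` such that `W x` is a coisotropic subspace of `T x` for all `x ∈ U`. -/
def IsCoisotropicAction {Γ X : Type*} [TopologicalSpace X] (M : Set X) (act : Γ → X → X)
    (T : X → Type*) [∀ x, AddCommGroup (T x)] [∀ x, Module ℂ (T x)]
    (Ω : ∀ x, LinearMap.BilinForm ℂ (T x)) (W : ∀ x, Submodule ℂ (T x)) : Prop :=
  ∃ U : Set X, (∃ V : Set X, IsOpen V ∧ U = M ∩ V) ∧ M ⊆ closure U ∧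
    (∀ h : Γ, ∀ x ∈ U, act h x ∈ U) ∧ ∀ x ∈ U, IsCoisotropic (Ω x) (W x)

section LieGroup

set_option linter.unusedSectionVars false

variable (E : Type*) [NormedAddCommGroup E] [NormedSpace ℂ E]
  (G : Type*) [TopologicalSpace G] [ChartedSpace E G] [Group G]

/-- The Lie algebra of a complex Lie group `G` modelled on `E`: the tangent space at the identity,
with the bracket of left-invariant vector fields. -/
abbrev LieAlg : Type _ := GroupLieAlgebra 𝓘(ℂ, E) G

/-- The dual space of the Lie algebra. -/
abbrev LieDual : Type _ := LieAlg E G →L[ℂ] ℂ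

variable {G}

/-! ### The coadjoint orbits -/

/-- The adjoint action `Ad(g)`: the derivative at the identity of `x ↦ g x g⁻¹`. -/
def Ad (g : G) : LieAlg E G →L[ℂ] LieAlg E G :=
  mfderiv 𝓘(ℂ, E) 𝓘(ℂ, E) (fun x : G => g * x * g⁻¹) 1

variable {E}

/-- The coadjoint action `(Ad*(g) l)(X) = l (Ad(g⁻¹) X)`. -/
def coAd (g : G) (l : LieDual E G) : LieDual E G := l.comp (Ad E g⁻¹)

/-- The coadjoint orbit of `G` through `l`. -/
def coadjointOrbit (l : LieDual E G) : Set (LieDual E G) := Set.range fun g : G => coAd g l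

variable [LieGroup 𝓘(ℂ, E) ω G]

/-! ### The Lie algebra of a subgroup -/

/-- The velocity at time `0` of a holomorphic curve in `G`. -/
def velocity (γ : ℂ → G) : E := mfderiv 𝓘(ℂ, ℂ) 𝓘(ℂ, E) γ 0 (1 : ℂ)

/-- `X` is the velocity at time `0` of a holomorphic curve in `G` that passes through the identity
at time `0` and stays in the subgroup `K` for small times. -/
def IsVelocityIn (K : Subgroup G) (X : LieAlg E G) : Prop :=
  ∃ γ : ℂ → G, γ 0 = 1 ∧ (∀ᶠ z in 𝓝 (0 : ℂ), γ z ∈ K) ∧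
    ContMDiffAt 𝓘(ℂ, ℂ) 𝓘(ℂ, E) ω γ 0 ∧ (velocity γ : E) = X

lemma mfderiv_mul_one (a b : G) (ha : a = 1) (hb : b = 1) (v w : E) :
    (mfderiv (𝓘(ℂ, E).prod 𝓘(ℂ, E)) 𝓘(ℂ, E) (fun p : G × G => p.1 * p.2) (a, b)
      ((v, w) : E × E) : E) = v + w := by
  subst ha hb
  have h : MDifferentiableAt (𝓘(ℂ, E).prod 𝓘(ℂ, E)) 𝓘(ℂ, E) (fun p : G × G => p.1 * p.2)
      ((1 : G), (1 : G)) :=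
    ((contMDiff_mul 𝓘(ℂ, E) ω (G := G)).contMDiffAt).mdifferentiableAt (by simp)
  have h1 := mfderiv_prod_eq_add_apply (v := ((v, w) : E × E)) h
  have e1 : (mfderiv 𝓘(ℂ, E) 𝓘(ℂ, E) (fun z : G => z * 1) 1 v : E) = v := by
    have e : (fun z : G => z * 1) = id := by ext; simp
    rw [e, mfderiv_id]
    rfl
  have e2 : (mfderiv 𝓘(ℂ, E) 𝓘(ℂ, E) (fun z : G => 1 * z) 1 w : E) = w := by
    have e : (fun z : G => 1 * z) = id := by ext; simp
    rw [e, mfderiv_id]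
    rfl
  exact h1.trans (congrArg₂ (fun x y : E => x + y) e1 e2)

lemma velocity_mul {γ δ : ℂ → G} (h0 : γ 0 = 1) (k0 : δ 0 = 1)
    (hd : ContMDiffAt 𝓘(ℂ, ℂ) 𝓘(ℂ, E) ω γ 0) (kd : ContMDiffAt 𝓘(ℂ, ℂ) 𝓘(ℂ, E) ω δ 0) :
    (velocity (fun z => γ z * δ z) : E) = velocity γ + velocity δ := by
  have h1 : MDifferentiableAt 𝓘(ℂ, ℂ) 𝓘(ℂ, E) γ 0 := hd.mdifferentiableAt (by simp)
  have h2 : MDifferentiableAt 𝓘(ℂ, ℂ) 𝓘(ℂ, E) δ 0 := kd.mdifferentiableAt (by simp)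
  have h3 : MDifferentiableAt (𝓘(ℂ, E).prod 𝓘(ℂ, E)) 𝓘(ℂ, E)
      (fun p : G × G => p.1 * p.2) (γ 0, δ 0) :=
    ((contMDiff_mul 𝓘(ℂ, E) ω (G := G)).contMDiffAt).mdifferentiableAt (by simp)
  have h4 := mfderiv_comp (I := 𝓘(ℂ, ℂ)) (0 : ℂ) h3 (h1.prodMk h2)
  rw [mfderiv_prodMk h1 h2] at h4
  have h5 := congrArg (fun L : ℂ →L[ℂ] E => L 1) h4
  exact h5.trans (mfderiv_mul_one (γ 0) (δ 0) h0 k0 (velocity γ) (velocity δ))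

lemma velocity_comp_mul (c : ℂ) {γ : ℂ → G} (hd : ContMDiffAt 𝓘(ℂ, ℂ) 𝓘(ℂ, E) ω γ 0) :
    (velocity (fun z => γ (c * z)) : E) = c • velocity γ := by
  have hc : ContDiff ℂ ω (fun z : ℂ => c * z) := contDiff_const.mul contDiff_id
  have hd' : MDifferentiableAt 𝓘(ℂ, ℂ) 𝓘(ℂ, E) γ (c * 0) := by
    rw [mul_zero]
    exact hd.mdifferentiableAt (by simp)
  have h1 := mfderiv_comp (I := 𝓘(ℂ, ℂ)) (I' := 𝓘(ℂ, ℂ)) (I'' := 𝓘(ℂ, E)) (g := γ)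
    (f := fun z : ℂ => c * z) (0 : ℂ) hd' (hc.contMDiff.contMDiffAt.mdifferentiableAt (by simp))
  have h2 := congrArg (fun L : ℂ →L[ℂ] E => L 1) h1
  have h3 : (mfderiv 𝓘(ℂ, ℂ) 𝓘(ℂ, ℂ) (fun z : ℂ => c * z) 0 (1 : ℂ) : ℂ) = c := by
    rw [mfderiv_eq_fderiv]
    change fderiv ℂ (fun z : ℂ => c * z) 0 1 = c
    simp
  have h4 : ∀ w : ℂ, w = 0 → (mfderiv 𝓘(ℂ, ℂ) 𝓘(ℂ, E) γ w c : E) = c • (velocity γ : E) := by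
    rintro w rfl
    have h5 := ContinuousLinearMap.map_smul
      (show ℂ →L[ℂ] E from mfderiv 𝓘(ℂ, ℂ) 𝓘(ℂ, E) γ 0) c (1 : ℂ)
    rw [smul_eq_mul, mul_one] at h5
    exact h5
  refine h2.trans (Eq.trans ?_ (h4 (c * 0) (mul_zero c)))
  exact congrArg (fun x : ℂ => (mfderiv 𝓘(ℂ, ℂ) 𝓘(ℂ, E) γ (c * 0) x : E)) h3

/-- The Lie algebra of a complex Lie subgroup `K` of `G`: the space of all velocities at the
identity of holomorphic curves in `K`. -/
def subgroupAlg (K : Subgroup G) : Submodule ℂ (LieAlg E G) where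
  carrier := {X | IsVelocityIn K X}
  zero_mem' := by
    refine ⟨fun _ => 1, rfl, Filter.Eventually.of_forall fun _ => K.one_mem, contMDiffAt_const, ?_⟩
    unfold velocity
    rw [mfderiv_const]
    rfl
  add_mem' := by
    rintro X Y ⟨γ, h0, hK, hd, hX⟩ ⟨δ, k0, kK, kd, hY⟩
    refine ⟨fun z => γ z * δ z, by simp [h0, k0], ?_, hd.mul kd, ?_⟩
    · filter_upwards [hK, kK] with z h1 h2 using K.mul_mem h1 h2
    · rw [velocity_mul h0 k0 hd kd, hX, hY]
      rfl
  smul_mem' := by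
    rintro c X ⟨γ, h0, hK, hd, hX⟩
    have hc : ContDiff ℂ ω (fun z : ℂ => c * z) := contDiff_const.mul contDiff_id
    have hd' : ContMDiffAt 𝓘(ℂ, ℂ) 𝓘(ℂ, E) ω γ (c * 0) := by rw [mul_zero]; exact hd
    refine ⟨fun z => γ (c * z), by simp [h0], ?_,
      hd'.comp (f := fun z : ℂ => c * z) 0 hc.contMDiff.contMDiffAt, ?_⟩
    · have ht : Filter.Tendsto (fun z : ℂ => c * z) (𝓝 0) (𝓝 0) := by
        simpa using hc.continuous.tendsto (0 : ℂ)
      exact ht.eventually hK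
    · rw [velocity_comp_mul c hd, hX]
      rfl

/-! ### The minimal nilpotent orbit -/

variable [CompleteSpace E]

/-- An element `l` of the dual of the Lie algebra is nilpotent if it is represented, with respect
to the Killing form, by an element `X` such that `ad X` is nilpotent. -/
def IsNilpotentFunctional (l : LieDual E G) : Prop :=
  ∃ X : LieAlg E G, IsNilpotent (LieAlgebra.ad ℂ (LieAlg E G) X) ∧
    ∀ Y, l Y = killingForm ℂ (LieAlg E G) X Y

/-- `O` is a nonzero nilpotent coadjoint orbit. -/
def IsNonzeroNilpotentOrbit (O : Set (LieDual E G)) : Prop :=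
  ∃ l : LieDual E G, l ≠ 0 ∧ IsNilpotentFunctional l ∧ O = coadjointOrbit l

/-- `O` is minimal, for the closure ordering, among the nonzero nilpotent coadjoint orbits. -/
def IsMinimalNilpotentOrbit (O : Set (LieDual E G)) : Prop :=
  IsNonzeroNilpotentOrbit O ∧
    ∀ O' : Set (LieDual E G), IsNonzeroNilpotentOrbit O' → O' ⊆ closure O → O' = O

/-! ### The Kirillov-Kostant-Souriau form -/

/-- The bilinear form `(X, Y) ↦ l ([X, Y])` on the Lie algebra. -/
def bracketForm (l : LieDual E G) : LinearMap.BilinForm ℂ (LieAlg E G) :=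
  LinearMap.mk₂ ℂ (fun X Y : LieAlg E G => l ⁅X, Y⁆)
    (fun _ _ _ => by rw [add_lie, map_add]) (fun _ _ _ => by rw [smul_lie, map_smul])
    (fun _ _ _ => by rw [lie_add, map_add]) (fun _ _ _ => by rw [lie_smul, map_smul])

/-- The Lie algebra `{Y | l ([X, Y]) = 0 for all X}` of the stabilizer of `l`. -/
def stabilizerAlg (l : LieDual E G) : Submodule ℂ (LieAlg E G) where
  carrier := {Y | ∀ X : LieAlg E G, l ⁅X, Y⁆ = 0}
  zero_mem' := fun X => by rw [lie_zero, map_zero]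
  add_mem' := fun {a b} ha hb X => by rw [lie_add, map_add, ha X, hb X, add_zero]
  smul_mem' := fun c a ha X => by rw [lie_smul, map_smul, ha X, smul_zero]

/-- The tangent space at `l` of the coadjoint orbit through `l`: the Lie algebra of `G` modulo the
Lie algebra of the stabilizer of `l`. -/
abbrev OrbitTangent (l : LieDual E G) : Type _ := LieAlg E G ⧸ stabilizerAlg l

/-- The Kirillov-Kostant-Souriau symplectic form on the tangent space at `l` of the coadjoint orbit
through `l`, induced by `(X, Y) ↦ l ([X, Y])`. -/
def kks (l : LieDual E G) : LinearMap.BilinForm ℂ (OrbitTangent l) :=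
  (bracketForm l).liftQ₂ (stabilizerAlg l) (stabilizerAlg l)
    (by
      intro Y hY
      rw [LinearMap.mem_ker]
      ext X
      change l ⁅Y, X⁆ = 0
      rw [← lie_skew, map_neg, hY X, neg_zero])
    (by
      intro Y hY
      rw [LinearMap.mem_ker]
      ext X
      exact hY X)

lemma kks_mk (l : LieDual E G) (X Y : LieAlg E G) :
    kks l (Submodule.Quotient.mk X) (Submodule.Quotient.mk Y) = l ⁅X, Y⁆ := rfl

/-- The symplectic form `Ω_l ⊕ Ω_m` on the tangent space at `(l, m)` of a product of two coadjoint
orbits. -/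
def kksProd (p : LieDual E G × LieDual E G) :
    LinearMap.BilinForm ℂ (OrbitTangent p.1 × OrbitTangent p.2) :=
  (kks p.1).compl₁₂ (LinearMap.fst ℂ _ _) (LinearMap.fst ℂ _ _) +
    (kks p.2).compl₁₂ (LinearMap.snd ℂ _ _) (LinearMap.snd ℂ _ _)

lemma kksProd_apply (p : LieDual E G × LieDual E G) (v w : OrbitTangent p.1 × OrbitTangent p.2) :
    kksProd p v w = kks p.1 v.1 w.1 + kks p.2 v.2 w.2 := rfl

/-! ### Symmetric pairs and the two actions -/

/-- `(G, K)` is a complex symmetric pair: `K` is an open subgroup of the fixed point group of a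
holomorphic involutive automorphism `θ` of `G`. -/
def IsComplexSymmetricPair (K : Subgroup G) : Prop :=
  ∃ θ : G ≃* G, ContMDiff 𝓘(ℂ, E) 𝓘(ℂ, E) ω θ ∧ (∀ g, θ (θ g) = g) ∧
    ∃ V : Set G, IsOpen V ∧ (K : Set G) = {g | θ g = g} ∩ V

/-- The coadjoint action of a complex Lie subgroup `K` of `G` on the coadjoint orbit `O` of `G` is
coisotropic.  The tangent space at `l` of the `K`-orbit of `l` is the image of the Lie algebra of
`K`. -/
def IsCoisotropicOnOrbit (K : Subgroup G) (O : Set (LieDual E G)) : Prop :=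
  IsCoisotropicAction O (fun (k : K) l => coAd (k : G) l) (fun l => OrbitTangent l) kks
    (fun l => (subgroupAlg K).map (stabilizerAlg l).mkQ)

/-- The diagonal action of `G` on the product `O × O'` of two coadjoint orbits is coisotropic.
The tangent space at `(l, m)` of the `G`-orbit of `(l, m)` is the image of the Lie algebra of `G`
under the diagonal map. -/
def IsDiagonalCoisotropic (O O' : Set (LieDual E G)) : Prop :=
  IsCoisotropicAction (O ×ˢ O')
    (fun (g : G) (p : LieDual E G × LieDual E G) => (coAd g p.1, coAd g p.2))
    (fun p => OrbitTangent p.1 × OrbitTangent p.2) kksProd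
    (fun p => LinearMap.range ((stabilizerAlg p.1).mkQ.prod (stabilizerAlg p.2).mkQ))

end LieGroup

end CoisotropicAction

end

/-! The Killing form, rescaled to a form `b`, identifies the dual with the Lie algebra. There the
minimal orbit becomes the set of nonzero extremal elements, those `x` with `(ad x)² z = 2 b(x, z)
x`. Such elements exist: take a root vector for a root that is maximal for a generic linear
functional. They form one orbit, since two non-orthogonal ones are exchanged inside the `sl₂` they
generate (`mem_of_isExtremal`). Contracting by `exp (ε⁻¹ ad y)` puts every extremal `y` in the
closure of every nonzero nilpotent orbit (`mem_closure_of_isExtremal`). Minimality then forces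
equality (`IsMinimalNilpotentOrbit.exists_eq_image`).

A tangent vector at `x` is determined by `[x, v]`. In the diagonal case, `(v, w)` is orthogonal to
the orbit exactly when `[x, v] = -[y, w]`. If `b(x, y) ≠ 0`, extremality confines such a common
vector of `[x, L]` and `[y, L]` to the line of `[x, y]` (`mem_span_lie`), and a multiple of `x + y`
realizes it diagonally. The condition `b(x, y) ≠ 0` is open and dense.

For an involution `θ`, the orthogonal of the tangent space of the orbit consists of the `v` with
`θ[x, v] = -[x, v]`, so that `[x, v]` lies in `[x, L] ∩ [θx, L]`. Where `b(x, θx) ≠ 0` the same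
argument applies, because `x + θx` is fixed. This locus is dense if some extremal `m ≠ 0` has `θm =
-m`, since the second derivatives at `m` of the quadratic form `b(x, θx)` do not all vanish. If no
such `m` exists, then `[x, θx] = 0` and `b(x, θx) = 0` for every extremal `x`. When moreover `θx ≠
x`, a nonzero `[x, v]` in the orthogonal would yield an extremal element reversed by `θ` in the span
of `x - θx` and `[x, v]` (`exists_in_span_sub`). So the orthogonal is zero on a dense open set,
unless `θ = 1`, where nothing is to be proved.

The Lie group enters in two ways: `exp (ad v)` is the adjoint action of a group element, and the Lie
algebra of `K` contains every vector fixed by the derivative of the involution. -/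

noncomputable section

namespace CoisotropicAction

/-! ### Algebra of extremal elements. -/

section ExtremalElements

variable {L : Type*} [LieRing L] [LieAlgebra ℂ L] {b : L →ₗ[ℂ] L →ₗ[ℂ] ℂ}

/-- A symmetric invariant bilinear form on a Lie algebra. -/
structure IsInvariantForm (b : L →ₗ[ℂ] L →ₗ[ℂ] ℂ) : Prop where
  symm : ∀ x y, b x y = b y x
  inv : ∀ x y z, b ⁅x, y⁆ z = b x ⁅y, z⁆

/-- `x` is extremal with respect to `b` if `(ad x)² z = 2 b(x, z) x` for all `z`. -/
def IsExtremal (b : L →ₗ[ℂ] L →ₗ[ℂ] ℂ) (x : L) : Prop :=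
  ∀ z, ⁅x, ⁅x, z⁆⁆ = (2 * b x z) • x

namespace IsInvariantForm

variable (hb : IsInvariantForm b)
include hb

lemma lie_left (x y z : L) : b ⁅x, y⁆ z = - b y ⁅x, z⁆ := by
  rw [← lie_skew, map_neg, LinearMap.neg_apply, hb.inv]

lemma self_lie (x y : L) : b x ⁅x, y⁆ = 0 := by
  rw [← hb.inv, lie_self, map_zero, LinearMap.zero_apply]

/-- The image of `ad y` is the orthogonal complement of its kernel. -/
lemma exists_lie_eq [FiniteDimensional ℂ L] (hnd : ∀ u, (∀ z, b u z = 0) → u = 0) {x y : L}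
    (h : ∀ z, ⁅y, z⁆ = 0 → b x z = 0) : ∃ u, ⁅y, u⁆ = x := by
  have h1 : b x ∈ (LieAlgebra.ad ℂ L y).ker.dualAnnihilator := by
    rw [Submodule.mem_dualAnnihilator]
    exact fun z hz => h z hz
  rw [← LinearMap.range_dualMap_eq_dualAnnihilator_ker] at h1
  obtain ⟨f, hf⟩ := h1
  have hinj : Function.Injective b := by
    rw [← LinearMap.ker_eq_bot, LinearMap.ker_eq_bot']
    exact fun u hu => hnd u fun z => by rw [hu, LinearMap.zero_apply]
  obtain ⟨u, rfl⟩ := (LinearMap.injective_iff_surjective_of_finrank_eq_finrank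
    (Subspace.dual_finrank_eq (K := ℂ) (V := L)).symm).mp hinj f
  refine ⟨-u, sub_eq_zero.mp (hnd _ fun z => ?_)⟩
  have h2 : b u ⁅y, z⁆ = b x z := LinearMap.congr_fun hf z
  rw [map_sub, LinearMap.sub_apply, ← h2, lie_neg, lie_skew, hb.inv, sub_self]

end IsInvariantForm

namespace IsExtremal

variable {x y : L}

lemma smul (hx : IsExtremal b x) (c : ℂ) : IsExtremal b (c • x) := by
  intro z
  simp only [smul_lie, lie_smul, hx z, map_smul, LinearMap.smul_apply, smul_smul, smul_eq_mul]
  ring_nf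

/-- With `X = ad x` and `Y = ad y`, `ad ((ad x)² y) = X²Y - 2XYX + YX²`. Extremality evaluates every
term except `XYX`, so the identity can be solved for it. -/
lemma lie_lie_lie (hb : IsInvariantForm b) (hx : IsExtremal b x) (y z : L) :
    ⁅x, ⁅y, ⁅x, z⁆⁆⁆ = b ⁅x, y⁆ z • x - b x z • ⁅x, y⁆ - b x y • ⁅x, z⁆ := by
  have h1 : ⁅⁅x, ⁅x, y⁆⁆, z⁆ = (2 * b x y) • ⁅x, z⁆ := by rw [hx y, smul_lie]
  have h2 : ⁅⁅x, ⁅x, y⁆⁆, z⁆ = ⁅x, ⁅x, ⁅y, z⁆⁆⁆ - (2 : ℂ) • ⁅x, ⁅y, ⁅x, z⁆⁆⁆ + ⁅y, ⁅x, ⁅x, z⁆⁆⁆ := by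
    simp only [lie_lie, lie_sub]
    module
  have h3 : ⁅y, x⁆ = -⁅x, y⁆ := (lie_skew y x).symm
  rw [h1, hx, hx, lie_smul, ← hb.inv, h3] at h2
  refine smul_right_injective L (two_ne_zero (α := ℂ)) ?_
  dsimp only
  rw [← sub_eq_zero] at h2 ⊢
  rw [← h2]
  module

/-- The linearization of extremality in a direction tangent to the set of extremal elements. -/
lemma lie_lie_tangent (hb : IsInvariantForm b) (hx : IsExtremal b x) {v : L} (hv : b x v = 0)
    (z : L) : ⁅x, ⁅⁅x, v⁆, z⁆⁆ = b ⁅x, v⁆ z • x + b x z • ⁅x, v⁆ := by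
  rw [lie_lie, lie_sub, hx, hx.lie_lie_lie hb, ← hb.inv, hv]
  module

/-- The key to coisotropy: applying `XYX` to `v`, with `[x, v]` also equal to `[y, w]`, leaves only
multiples of `x`, `[x, y]` and `b(x, y) [x, v]`. -/
lemma mem_span_lie (hb : IsInvariantForm b) (hx : IsExtremal b x) (hy : IsExtremal b y)
    (hxy : b x y ≠ 0) {v w : L} (h : ⁅x, v⁆ = ⁅y, w⁆) : ∃ c : ℂ, ⁅x, v⁆ = c • ⁅x, y⁆ := by
  have h1 := hx.lie_lie_lie hb y v
  rw [h, hy w, lie_smul, ← h] at h1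
  have h2 : b ⁅x, v⁆ y = 0 := by rw [h, hb.symm, hb.self_lie]
  have h3 : b ⁅x, y⁆ y = 0 := by rw [hb.inv, lie_self, map_zero]
  have h4 : (b x y) • ⁅x, v⁆ = b ⁅x, y⁆ v • x - (b x v + 2 * b y w) • ⁅x, y⁆ := by
    rw [← sub_eq_zero] at h1 ⊢
    rw [← h1]
    module
  -- Pairing with `y` kills everything but the coefficient of `x`, which must therefore vanish.
  have h5 := congrArg (fun u => b u y) h4
  simp only [map_smul, map_sub, LinearMap.smul_apply, LinearMap.sub_apply, h2, h3, smul_eq_mul,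
    mul_zero, sub_zero] at h5
  have h6 : b ⁅x, y⁆ v = 0 := (mul_eq_zero.mp h5.symm).resolve_right hxy
  rw [h6, zero_smul, zero_sub] at h4
  refine ⟨(b x y)⁻¹ * -(b x v + 2 * b y w), ?_⟩
  rw [mul_smul, neg_smul, ← h4, smul_smul, inv_mul_cancel₀ hxy, one_smul]

/-- Expanding `(ad [x, y])²` gives words in `ad x` and `ad y` that `lie_lie_lie` reduces;
orthogonality removes all terms not proportional to `[x, y]`. -/
lemma lie_of_orthogonal (hb : IsInvariantForm b) (hx : IsExtremal b x) (hy : IsExtremal b y)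
    (hxy : b x y = 0) : IsExtremal b ⁅x, y⁆ := by
  intro z
  have hyx : b y x = 0 := by rw [hb.symm, hxy]
  have e : ⁅y, x⁆ = -⁅x, y⁆ := (lie_skew y x).symm
  have e1 : ∀ z, b x ⁅y, z⁆ = b ⁅x, y⁆ z := fun z => (hb.inv x y z).symm
  have e2 : ∀ z, b y ⁅x, z⁆ = -b ⁅x, y⁆ z := fun z => by
    rw [← hb.inv, e, map_neg, LinearMap.neg_apply]
  have e3 : ⁅x, ⁅x, y⁆⁆ = 0 := by rw [hx, hxy, mul_zero, zero_smul]
  have e4 : ⁅y, ⁅x, y⁆⁆ = 0 := by rw [← neg_neg ⁅x, y⁆, ← e, lie_neg, hy, hyx]; simp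
  have e5 : ∀ z, b ⁅x, y⁆ ⁅y, z⁆ = 0 := fun z => by
    rw [← hb.inv, ← lie_skew, e4, neg_zero, map_zero, LinearMap.zero_apply]
  have e6 : ∀ z, b ⁅x, y⁆ ⁅x, z⁆ = 0 := fun z => by
    rw [← hb.inv, ← lie_skew, e3, neg_zero, map_zero, LinearMap.zero_apply]
  have h1 := hx.lie_lie_lie hb y ⁅y, z⁆
  have h2 := hy.lie_lie_lie hb x ⁅x, z⁆
  have h3 : ⁅x, ⁅y, ⁅y, ⁅x, z⁆⁆⁆⁆ = (2 * b y ⁅x, z⁆) • ⁅x, y⁆ := by rw [hy, lie_smul]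
  have h4 : ⁅y, ⁅x, ⁅x, ⁅y, z⁆⁆⁆⁆ = (2 * b x ⁅y, z⁆) • ⁅y, x⁆ := by rw [hx, lie_smul]
  have h5 : ⁅⁅x, y⁆, ⁅⁅x, y⁆, z⁆⁆ = ⁅x, ⁅y, ⁅x, ⁅y, z⁆⁆⁆⁆ - ⁅x, ⁅y, ⁅y, ⁅x, z⁆⁆⁆⁆ -
      ⁅y, ⁅x, ⁅x, ⁅y, z⁆⁆⁆⁆ + ⁅y, ⁅x, ⁅y, ⁅x, z⁆⁆⁆⁆ := by
    rw [lie_lie x y z, lie_lie, lie_sub, lie_sub, lie_sub, lie_sub]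
    abel
  simp only [e, e1, e2, e5, e6, map_neg, LinearMap.neg_apply, hxy, hyx] at h1 h2 h3 h4
  rw [h5, h1, h2, h3, h4]
  module

/-- Two distinct commuting orthogonal extremal elements whose tangent directions share a nonzero
`q` span, together with `q`, a space that contains an extremal element in the span of `x - y` and
`q`. -/
lemma exists_in_span_sub [FiniteDimensional ℂ L] (hb : IsInvariantForm b)
    (hnd : ∀ u, (∀ z, b u z = 0) → u = 0)
    (hx : IsExtremal b x) (hy : IsExtremal b y) (hne : x ≠ y) (hlie : ⁅x, y⁆ = 0)
    {q v w : L} (hq : q ≠ 0) (hv : q = ⁅x, v⁆) (hw : q = ⁅y, w⁆) (hxv : b x v = 0)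
    (hyw : b y w = 0) :
    ∃ s t : ℂ, s • (x - y) + t • q ≠ 0 ∧ IsExtremal b (s • (x - y) + t • q) := by
  have hlie' : ⁅y, x⁆ = 0 := by rw [← lie_skew, hlie, neg_zero]
  have comm : ∀ z : L, ⁅x, ⁅y, z⁆⁆ = ⁅y, ⁅x, z⁆⁆ := fun z => by
    rw [leibniz_lie x y, hlie, zero_lie, zero_add]
  have hxq : ⁅x, q⁆ = 0 := by rw [hv, hx, hxv, mul_zero, zero_smul]
  have hyq : ⁅y, q⁆ = 0 := by rw [hw, hy, hyw, mul_zero, zero_smul]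
  have commx : ∀ z : L, ⁅x, ⁅q, z⁆⁆ = ⁅q, ⁅x, z⁆⁆ := fun z => by
    rw [leibniz_lie x q, hxq, zero_lie, zero_add]
  have commy : ∀ z : L, ⁅y, ⁅q, z⁆⁆ = ⁅q, ⁅y, z⁆⁆ := fun z => by
    rw [leibniz_lie y q, hyq, zero_lie, zero_add]
  have Tx : ∀ z : L, ⁅x, ⁅q, z⁆⁆ = b q z • x + b x z • q := fun z => by
    rw [hv]; exact hx.lie_lie_tangent hb hxv z
  have Ty : ∀ z : L, ⁅y, ⁅q, z⁆⁆ = b q z • y + b y z • q := fun z => by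
    rw [hw]; exact hy.lie_lie_tangent hb hyw z
  -- If `x` lies in the image of `ad y`, the linearized identity evaluates `ad y ad x`, and `x - y`
  -- itself is extremal. Otherwise duality supplies `z` commuting with `y` and satisfying `b(x, z) =
  -- 1`.
  by_cases hmem : ∃ u, ⁅y, u⁆ = x
  · obtain ⟨u, hu⟩ := hmem
    refine ⟨1, 0, by simpa [sub_eq_zero] using hne, ?_⟩
    rw [one_smul, zero_smul, add_zero]
    have h1 : y = 0 ∨ b y u = 0 := by
      have h2 := hy u
      rw [hu, hlie'] at h2
      simpa [or_comm] using h2.symm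
    have h3 : ∀ z : L, ⁅y, ⁅x, z⁆⁆ = b x z • y + b y z • x := fun z => by
      rcases h1 with h1 | h1
      · simp [h1]
      · rw [← hu]; exact hy.lie_lie_tangent hb h1 z
    intro z
    simp only [sub_lie, lie_sub, hx z, hy z, comm, h3, map_sub, LinearMap.sub_apply]
    module
  · have hdual : ∃ z, ⁅y, z⁆ = 0 ∧ b x z = 1 := by
      by_contra! h1
      refine hmem (hb.exists_lie_eq hnd fun z hz => ?_)
      by_contra h2
      refine h1 ((b x z)⁻¹ • z) (by rw [lie_smul, hz, smul_zero]) ?_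
      rw [map_smul, smul_eq_mul, inv_mul_cancel₀ h2]
    obtain ⟨z, hyz, hxz⟩ := hdual
    have hbyz : b y z = 0 := by
      have h1 := hy z
      rw [hyz, lie_zero] at h1
      rcases smul_eq_zero.mp h1.symm with h2 | h2
      · simpa using h2
      · simp [h2]
    have hqz : b q z = 0 := by rw [hw, hb.lie_left, hyz, map_zero, neg_zero]
    set r := b q ⁅w, z⁆ with hr
    have hqqz : ⁅q, ⁅q, z⁆⁆ = r • y := by
      have h1 : ⁅q, z⁆ = ⁅y, ⁅w, z⁆⁆ := by
        conv_lhs => rw [hw]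
        rw [lie_lie, hyz, lie_zero, sub_zero]
      rw [h1, ← commy, Ty, ← hb.inv y w z, ← hw, hqz, zero_smul, add_zero]
    have hxv' : ⁅x, ⁅q, z⁆⁆ = q := by rw [Tx, hqz, hxz]; simp
    -- Since `q = [x, [q, z]]`, `ad q` is a commutator; this computes `(ad q)²` up to the one
    -- unknown operator `ad y ad x`.
    have hQQ : ∀ z' : L, ⁅q, ⁅q, z'⁆⁆ = (2 * b q z') • q + r •
        (b y z' • x + b x z' • y - ⁅y, ⁅x, z'⁆⁆) := by
      intro z'
      set v' := ⁅q, z⁆ with hv'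
      have h1 : ⁅q, z'⁆ = ⁅x, ⁅v', z'⁆⁆ - ⁅v', ⁅x, z'⁆⁆ := by
        conv_lhs => rw [← hxv']
        rw [lie_lie]
      have h2 : ⁅v', x⁆ = -q := by rw [← lie_skew, hxv']
      have h3 : ⁅v', q⁆ = -(r • y) := by rw [← lie_skew, hqqz]
      have h4 : b q ⁅v', z'⁆ = r * b y z' := by
        rw [← hb.inv, hqqz, map_smul, LinearMap.smul_apply, smul_eq_mul]
      have h5 : b x ⁅v', z'⁆ = b q z' := by rw [← hb.inv, hxv']
      have h6 : ⁅q, ⁅v', ⁅x, z'⁆⁆⁆ = r • ⁅y, ⁅x, z'⁆⁆ + ⁅v', ⁅x, ⁅q, z'⁆⁆⁆ := by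
        rw [leibniz_lie, hqqz, smul_lie, commx]
      rw [h1, lie_sub, ← commx, Tx, h6, h4, h5, Tx, lie_add, lie_smul, lie_smul, h2, h3]
      module
    -- In the square of `ad (s(x - y) + q)` the operator `ad y ad x` has coefficient `-2s² - r`; the
    -- choice of `s` makes it vanish.
    obtain ⟨s, hs⟩ := IsAlgClosed.exists_pow_nat_eq (-r / 2) (n := 2) two_pos
    refine ⟨s, 1, ?_, ?_⟩
    · rw [one_smul]
      intro h0
      have hs0 : s ≠ 0 := by
        rintro rfl
        exact hq (by simpa using h0)
      -- If the vector were zero, `x = y - s⁻¹ q` would lie in the image of `ad y`, because both `y`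
      -- and `q` do.
      refine hmem ?_
      have hyy : ∃ u, ⁅y, u⁆ = y := by
        by_cases h1 : y = 0
        · exact ⟨0, by simp [h1]⟩
        · obtain ⟨z1, hz1⟩ : ∃ z1, b y z1 ≠ 0 := by
            by_contra! h2
            exact h1 (hnd y h2)
          refine ⟨(2 * b y z1)⁻¹ • ⁅y, z1⁆, ?_⟩
          rw [lie_smul, hy, smul_smul, inv_mul_cancel₀ (by simpa using hz1), one_smul]
      obtain ⟨u, hu⟩ := hyy
      refine ⟨u - s⁻¹ • w, ?_⟩
      rw [lie_sub, lie_smul, hu, ← hw]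
      have h1 : q = -(s • (x - y)) := (neg_eq_of_add_eq_zero_right h0).symm
      rw [h1, smul_neg, smul_smul, inv_mul_cancel₀ hs0]
      module
    · intro z'
      simp only [one_smul, add_lie, lie_add, smul_lie, lie_smul, sub_lie, lie_sub, hx z', hy z',
        comm, hQQ z', ← commx, ← commy, Tx, Ty, map_sub, LinearMap.sub_apply, map_add,
        LinearMap.add_apply, map_smul, LinearMap.smul_apply, smul_eq_mul]
      have hr' : r = -2 * s ^ 2 := by rw [hs]; ring
      rw [hr']
      module

end IsExtremal

end ExtremalElements

/-! ### Existence of extremal elements from a maximal root. -/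

section ExistsExtremal

variable (L : Type*) [LieRing L] [LieAlgebra ℂ L]

lemma isInvariantForm_smul_killingForm (κ : ℂ) : IsInvariantForm (κ • killingForm ℂ L) where
  symm x y := by
    simp only [LinearMap.smul_apply]
    rw [LieModule.traceForm_comm]
  inv x y z := by
    simp only [LinearMap.smul_apply]
    rw [LieModule.traceForm_apply_lie_apply]

variable [FiniteDimensional ℂ L]

open LieAlgebra LieAlgebra.IsKilling LieModule

/-- The second power of the adjoint action of a root vector for a root that is maximal with
respect to some linear functional has rank one. -/
lemma exists_sl2Triple_forall_lie_lie_mem_span [IsKilling ℂ L] (hL : ¬ IsLieAbelian L) :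
    ∃ h e f : L, IsSl2Triple h e f ∧ ∀ z, ∃ c : ℂ, ⁅e, ⁅e, z⁆⁆ = c • e := by
  obtain ⟨x0, hx0⟩ := exists_isCartanSubalgebra_engel ℂ L
  set H := LieSubalgebra.engel ℂ x0
  have hex : ∃ α : Weight ℂ H L, α.IsNonZero := by
    -- Without nonzero roots the Lie algebra equals its Cartan subalgebra, which is abelian.
    by_contra! hno
    apply hL
    have htop : (⊤ : LieSubmodule ℂ H L) ≤ rootSpace H (0 : H → ℂ) := by
      rw [← LieModule.iSup_genWeightSpace_eq_top ℂ H L, iSup_le_iff]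
      intro χ
      by_cases hχ : genWeightSpace L χ = ⊥
      · rw [hχ]; exact bot_le
      · have h0 := hno ⟨χ, hχ⟩
        have h1 : χ = 0 := h0.eq
        rw [h1]
    have hmem : ∀ z : L, z ∈ H := fun z => by
      have h1 : z ∈ rootSpace H (0 : H → ℂ) := htop (LieSubmodule.mem_top z)
      rw [← LieSubalgebra.mem_toLieSubmodule]
      rwa [rootSpace_zero_eq ℂ L H] at h1
    refine ⟨fun x y => ?_⟩
    have h1 : ⁅(⟨x, hmem x⟩ : H), (⟨y, hmem y⟩ : H)⁆ = 0 := trivial_lie_zero _ _ _ _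
    simpa using congrArg (fun z : H => (z : L)) h1
  let v : {p : Weight ℂ H L × Weight ℂ H L // p.1 ≠ p.2} → (H → ℂ) :=
    fun p => (p.1.1 : H → ℂ) - (p.1.2 : H → ℂ)
  -- A `ℚ`-linear functional separating the finitely many weights replaces the choice of a positive
  -- system.
  obtain ⟨φ, hφ⟩ := Module.exists_dual_forall_apply_ne_zero (K := ℚ) v fun p h0 => p.2 (by
    exact DFunLike.coe_injective (sub_eq_zero.mp h0))
  have hinj : ∀ α β : Weight ℂ H L, φ α = φ β → α = β := by
    intro α β h
    by_contra hne
    exact hφ ⟨(α, β), hne⟩ (by simp only [v, map_sub, h, sub_self])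
  obtain ⟨α, hα, hmax⟩ := Set.exists_max_image {α : Weight ℂ H L | α.IsNonZero}
    (fun α => φ α) (Set.toFinite _) hex
  have hmax' : ∀ β : Weight ℂ H L, β.IsNonZero → φ β ≤ φ α := hmax
  have hneg : ∀ β : Weight ℂ H L, φ (-β : Weight ℂ H L) = - φ β := fun β => by
    rw [Weight.coe_neg, map_neg]
  have hpos : 0 < φ α := by
    have h1 := hmax' (-α) (by simpa using hα)
    rw [hneg] at h1
    rcases lt_or_eq_of_le (show 0 ≤ φ α by linarith) with h2 | h2
    · exact h2
    · exfalso
      have h3 : -α = α := hinj _ _ (by rw [hneg, ← h2, neg_zero])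
      have h4 : -(α : H → ℂ) = α := by rw [← Weight.coe_neg, h3]
      apply hα
      exact self_eq_neg.mp h4.symm
  obtain ⟨h, e, f, ht, he, hf⟩ := exists_isSl2Triple_of_weight_isNonZero hα
  refine ⟨h, e, f, ht, fun z => ?_⟩
  have hz : z ∈ ⨆ χ : H → ℂ, rootSpace H χ := by simp [LieModule.iSup_genWeightSpace_eq_top]
  induction hz using LieSubmodule.iSup_induction' with
  | mem χ z hz =>
    have h1 : ⁅e, ⁅e, z⁆⁆ ∈ rootSpace H ((α : H → ℂ) + (α + χ)) :=
      lie_mem_genWeightSpace_of_mem_genWeightSpace he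
        (lie_mem_genWeightSpace_of_mem_genWeightSpace he hz)
    by_cases hχ : rootSpace H χ = ⊥
    · rw [hχ, LieSubmodule.mem_bot] at hz
      exact ⟨0, by simp [hz]⟩
    by_cases hs : rootSpace H ((α : H → ℂ) + (α + χ)) = ⊥
    · rw [hs, LieSubmodule.mem_bot] at h1
      exact ⟨0, by simp [h1]⟩
    let χ' : Weight ℂ H L := ⟨χ, hχ⟩
    let σ : Weight ℂ H L := ⟨(α : H → ℂ) + (α + χ), hs⟩
    have hσ : φ σ = φ α + (φ α + φ χ') := by
      change φ ((α : H → ℂ) + (α + χ)) = _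
      rw [map_add, map_add]
      rfl
    have hφ0 : ∀ β : Weight ℂ H L, ¬ β.IsNonZero → φ β = 0 := by
      intro β hβ
      rw [(not_not.mp hβ).eq, map_zero]
    -- As `χ ≥ -α` in this order, `2α + χ ≥ α`. Maximality forces `2α + χ = α`, so `(ad e)² z` lies
    -- in the one-dimensional root space of `α`.
    have hχ1 : -φ χ' ≤ φ α := by
      by_cases h2 : χ'.IsNonZero
      · rw [← hneg]
        exact hmax' _ (by simpa using h2)
      · rw [hφ0 _ h2]; linarith
    have hσ1 : φ σ ≤ φ α := by
      by_cases h2 : σ.IsNonZero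
      · exact hmax' _ h2
      · rw [hφ0 _ h2]; linarith
    have h2 : σ = α := hinj _ _ (by linarith)
    have h3 : ⁅e, ⁅e, z⁆⁆ ∈ rootSpace H α := by
      have h4 : ((α : H → ℂ) + (α + χ)) = α := congrArg (fun β : Weight ℂ H L => (β : H → ℂ)) h2
      rwa [h4] at h1
    obtain ⟨c, hc⟩ := (finrank_eq_one_iff_of_nonzero' (⟨e, he⟩ : rootSpace H α)
      (by simpa using ht.e_ne_zero)).mp (finrank_rootSpace_eq_one α hα) ⟨_, h3⟩
    exact ⟨c, by simpa using (congrArg Subtype.val hc).symm⟩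
  | zero => exact ⟨0, by simp⟩
  | add y z _ _ hy hz =>
    obtain ⟨c, hc⟩ := hy
    obtain ⟨d, hd⟩ := hz
    exact ⟨c + d, by rw [lie_add, lie_add, hc, hd, add_smul]⟩

/-- For a suitable multiple of the Killing form there is a nonzero extremal element. -/
lemma exists_isExtremal_smul_killingForm [IsKilling ℂ L] (hL : ¬ IsLieAbelian L) :
    ∃ κ : ℂ, κ ≠ 0 ∧ ∃ e : L, e ≠ 0 ∧ IsExtremal (κ • killingForm ℂ L) e := by
  obtain ⟨h, e, f, ht, hc⟩ := exists_sl2Triple_forall_lie_lie_mem_span L hL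
  have inv : IsInvariantForm (killingForm ℂ L) := by
    simpa using isInvariantForm_smul_killingForm L 1
  have hef : ⁅e, ⁅e, f⁆⁆ = (-2 : ℂ) • e := by
    rw [ht.lie_e_f, ← lie_skew, ht.lie_h_e_smul ℂ, neg_smul]
  -- Moving `ad e` twice across the Killing form determines the scalar in `(ad e)² z = c e`, and
  -- forces the normalization `κ = -1 / K(e, f)`.
  have key : ∀ z, ∀ c : ℂ, ⁅e, ⁅e, z⁆⁆ = c • e →
      c * killingForm ℂ L e f = -2 * killingForm ℂ L e z := by
    intro z c hz
    have h1 : killingForm ℂ L ⁅e, ⁅e, z⁆⁆ f = killingForm ℂ L ⁅e, ⁅e, f⁆⁆ z := by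
      rw [inv.lie_left, inv.lie_left, neg_neg, inv.symm]
    rw [hz, hef] at h1
    simpa using h1
  have hne : killingForm ℂ L e f ≠ 0 := by
    intro h0
    refine ht.e_ne_zero ?_
    have h1 : e ∈ LinearMap.ker (killingForm ℂ L) := by
      rw [LinearMap.mem_ker]
      ext z
      obtain ⟨c, hz⟩ := hc z
      have := key z c hz
      rw [h0, mul_zero] at this
      simpa using this.symm
    simpa using h1
  refine ⟨-(killingForm ℂ L e f)⁻¹, by simpa using hne, e, ht.e_ne_zero, fun z => ?_⟩
  obtain ⟨c, hz⟩ := hc z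
  have h1 := key z c hz
  rw [hz]
  congr 1
  simp only [LinearMap.smul_apply, smul_eq_mul]
  field_simp
  linear_combination h1

end ExistsExtremal

/-! ### Sets stable under exponentials of the adjoint action. -/

section AdExp

variable {L : Type*} [LieRing L] [LieAlgebra ℂ L] [TopologicalSpace L]

/-- The properties of the map `(w, x) ↦ exp (ad w) x` that do not refer to a norm. -/
structure IsAdExp (A : L → L → L) : Prop where
  neg_apply : ∀ w x, A (-w) (A w x) = x
  apply_smul : ∀ w (c : ℂ) x, A w (c • x) = c • A w x
  lie : ∀ w x y, A w ⁅x, y⁆ = ⁅A w x, A w y⁆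
  continuous : ∀ w, Continuous (A w)
  continuous_smul : ∀ w x, Continuous fun t : ℂ => A (t • w) x
  hasDerivAt : ∀ (w x : L) (φ : L →ₗ[ℂ] ℂ) (t : ℂ),
    HasDerivAt (fun t : ℂ => φ (A (t • w) x)) (φ (A (t • w) ⁅w, x⁆)) t
  hasDerivAt₂ : ∀ (w x y : L) (β : L →ₗ[ℂ] L →ₗ[ℂ] ℂ) (t : ℂ),
    HasDerivAt (fun t : ℂ => β (A (t • w) x) (A (t • w) y))
      (β (A (t • w) ⁅w, x⁆) (A (t • w) y) + β (A (t • w) x) (A (t • w) ⁅w, y⁆)) t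
  of_lie_lie_lie_eq_zero : ∀ w x, ⁅w, ⁅w, ⁅w, x⁆⁆⁆ = 0 →
    A w x = x + ⁅w, x⁆ + (2⁻¹ : ℂ) • ⁅w, ⁅w, x⁆⁆
  of_lie_eq_smul : ∀ (w x : L) (c : ℂ), ⁅w, x⁆ = c • x → A w x = Complex.exp c • x

namespace IsAdExp

variable {A : L → L → L} (hA : IsAdExp A) {b : L →ₗ[ℂ] L →ₗ[ℂ] ℂ}
include hA

lemma zero_apply (x : L) : A 0 x = x := by
  simpa using hA.of_lie_eq_smul 0 x 0 (by simp)

lemma smul_self (t : ℂ) (w : L) : A (t • w) w = w := by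
  simpa using hA.of_lie_eq_smul (t • w) w 0 (by simp)

/-- Along `t ↦ exp (t ad w)` the value has derivative zero by invariance of `b`. -/
lemma form_apply (hb : IsInvariantForm b) (w x y : L) : b (A w x) (A w y) = b x y := by
  have h1 : ∀ t : ℂ, HasDerivAt (fun t : ℂ => b (A (t • w) x) (A (t • w) y)) 0 t := by
    intro t
    convert hA.hasDerivAt₂ w x y b t using 1
    rw [hA.lie, hA.lie, hA.smul_self, hb.lie_left, neg_add_cancel]
  have h2 := is_const_of_deriv_eq_zero (fun t => (h1 t).differentiableAt)
    (fun t => (h1 t).deriv) 1 0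
  simpa [hA.zero_apply] using h2

lemma isExtremal_apply (hb : IsInvariantForm b) {x : L} (hx : IsExtremal b x) (w : L) :
    IsExtremal b (A w x) := by
  intro z
  have h1 : A w (A (-w) z) = z := by simpa using hA.neg_apply (-w) z
  rw [← h1, ← hA.lie, ← hA.lie, hx, hA.form_apply hb, hA.apply_smul]

section Vanishing

variable {S N : Set L} (hS : ∀ w, ∀ x ∈ S, A w x ∈ S)
include hS

lemma eventually_mem (hN : IsOpen N) {x : L} (hx : x ∈ S) (hxN : x ∈ N) (w : L) :
    ∀ᶠ t : ℂ in 𝓝 0, A (t • w) x ∈ S ∧ A (t • w) x ∈ N := by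
  have h1 : Filter.Tendsto (fun t : ℂ => A (t • w) x) (𝓝 0) (𝓝 x) := by
    simpa [hA.zero_apply] using (hA.continuous_smul w x).tendsto 0
  filter_upwards [h1.eventually (hN.mem_nhds hxN)] with t ht using ⟨hS _ _ hx, ht⟩

/-- A linear form that vanishes on a nonempty open piece of a stable set is zero. -/
lemma eq_zero_of_vanishing [LieAlgebra.IsSimple ℂ L] (hN : IsOpen N) {x₀ : L} (h₀ : x₀ ≠ 0)
    (hx₀ : x₀ ∈ S) (hx₀N : x₀ ∈ N) {φ : L →ₗ[ℂ] ℂ} (hφ : ∀ x ∈ S, x ∈ N → φ x = 0) : φ = 0 := by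
  have stable : ∀ φ : L →ₗ[ℂ] ℂ, (∀ x ∈ S, x ∈ N → φ x = 0) →
      ∀ w : L, ∀ x ∈ S, x ∈ N → φ ⁅w, x⁆ = 0 := by
    intro φ hφ w x hx hxN
    have h1 := hA.hasDerivAt w x φ 0
    rw [zero_smul, hA.zero_apply] at h1
    have h2 : (fun t : ℂ => φ (A (t • w) x)) =ᶠ[𝓝 0] fun _ => 0 := by
      filter_upwards [hA.eventually_mem hS hN hx hxN w] with t ht using hφ _ ht.1 ht.2
    exact h1.unique ((hasDerivAt_const (0 : ℂ) (0 : ℂ)).congr_of_eventuallyEq h2)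
  -- This is the span of `S ∩ N`, written as a double annihilator. Differentiating along `exp (t ad
  -- w)` shows that it is an ideal, and it contains `x₀ ≠ 0`.
  let I : LieIdeal ℂ L :=
    { carrier := {z | ∀ φ : L →ₗ[ℂ] ℂ, (∀ x ∈ S, x ∈ N → φ x = 0) → φ z = 0}
      zero_mem' := fun φ _ => map_zero φ
      add_mem' := fun {y z} hy hz φ h => by rw [map_add, hy φ h, hz φ h, add_zero]
      smul_mem' := fun c z hz φ h => by rw [map_smul, hz φ h, smul_zero]
      lie_mem := fun {w z} hz φ h => hz (φ ∘ₗ LieAlgebra.ad ℂ L w) (stable φ h w) }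
  have hI : I = ⊤ := by
    refine (LieAlgebra.IsSimple.eq_bot_or_eq_top I).resolve_left fun h => h₀ ?_
    rw [← LieSubmodule.mem_bot (R := ℂ) (L := L), ← h]
    exact fun φ h => h x₀ hx₀ hx₀N
  ext z
  have hz : z ∈ I := by rw [hI]; exact LieSubmodule.mem_top z
  exact hz φ hφ

lemma exists_form_ne_zero [LieAlgebra.IsSimple ℂ L] (hnd : ∀ u, (∀ z, b u z = 0) → u = 0)
    (hN : IsOpen N) {x₀ : L} (h₀ : x₀ ≠ 0) (hx₀ : x₀ ∈ S) (hx₀N : x₀ ∈ N) {y : L} (hy : y ≠ 0) :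
    ∃ x ∈ S, x ∈ N ∧ b y x ≠ 0 := by
  by_contra! h
  refine hy (hnd y fun z => ?_)
  rw [hA.eq_zero_of_vanishing hS hN h₀ hx₀ hx₀N h, LinearMap.zero_apply]

/-- A stable set that contains a nonzero extremal element contains all of them. -/
lemma mem_of_isExtremal [LieAlgebra.IsSimple ℂ L] (hb : IsInvariantForm b)
    (hnd : ∀ u, (∀ z, b u z = 0) → u = 0) {x y : L} (hx : IsExtremal b x) (hx0 : x ≠ 0)
    (hxS : x ∈ S) (hy : IsExtremal b y) (hy0 : y ≠ 0) : y ∈ S := by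
  obtain ⟨x', ⟨hx'S, hx'⟩, -, hyx⟩ := hA.exists_form_ne_zero (S := {x | x ∈ S ∧ IsExtremal b x})
    (fun w x hx => ⟨hS w x hx.1, hA.isExtremal_apply hb hx.2 w⟩) hnd isOpen_univ hx0 ⟨hxS, hx⟩
    (Set.mem_univ x) hy0
  have hxy : b x' y ≠ 0 := by rwa [hb.symm]
  -- With `s² b(x', y) = 1`, the product `exp (s ad x') exp (s ad y)` carries `x'` to `y`, as a Weyl
  -- reflection in `sl₂` would.
  obtain ⟨s, hs⟩ := IsAlgClosed.exists_pow_nat_eq (b x' y)⁻¹ (n := 2) two_pos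
  have hs0 : s ≠ 0 := by
    rintro rfl
    rw [zero_pow two_ne_zero] at hs
    exact inv_ne_zero hxy hs.symm
  have hs2 : s * s * b x' y = 1 := by
    rw [← sq, hs, inv_mul_cancel₀ hxy]
  have hyx' : ⁅y, x'⁆ = -⁅x', y⁆ := (lie_skew y x').symm
  have e1 : A (s • y) x' = x' - s • ⁅x', y⁆ + y := by
    rw [hA.of_lie_lie_lie_eq_zero]
    · simp only [smul_lie, lie_smul, hy x', hb.symm y x', smul_smul]
      rw [hyx', show (2⁻¹ : ℂ) * (s * (s * (2 * b x' y))) = 1 by linear_combination hs2]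
      module
    · simp [hy x']
  have e2 : A (s • x') (A (s • y) x') = y := by
    rw [e1, hA.of_lie_lie_lie_eq_zero]
    · simp only [smul_lie, lie_smul, lie_sub, lie_add, lie_self, hx' y, smul_smul, smul_zero,
        lie_zero]
      have h3 : b x' y = s⁻¹ * s⁻¹ := by field_simp; linear_combination hs2
      rw [h3]
      match_scalars <;> field_simp <;> ring
    · simp [hx' y]
  rw [← e2]
  exact hS _ _ (hS _ _ hx'S)

omit hS

/-- The closure of the orbit cone of a nonzero nilpotent element contains all extremal elements. -/
lemma mem_closure_of_isExtremal [LieAlgebra.IsSimple ℂ L] [FiniteDimensional ℂ L]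
    [ContinuousAdd L] [ContinuousSMul ℂ L]
    (hS : ∀ w, ∀ x ∈ S, A w x ∈ S) (hnd : ∀ u, (∀ z, b u z = 0) → u = 0) {x h y : L}
    (hx0 : x ≠ 0) (hx : ⁅h, x⁆ = x) (hxS : x ∈ S) (hy : IsExtremal b y) (hy0 : y ≠ 0) :
    y ∈ closure S := by
  obtain ⟨x', ⟨hx'S, h', hx'⟩, -, hyx⟩ := hA.exists_form_ne_zero
    (S := {x | x ∈ S ∧ ∃ h, ⁅h, x⁆ = x})
    (fun w x hx => ⟨hS w x hx.1, by
      obtain ⟨h, hh⟩ := hx.2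
      exact ⟨A w h, by rw [← hA.lie, hh]⟩⟩) hnd isOpen_univ hx0 ⟨hxS, h, hx⟩
    (Set.mem_univ x) hy0
  set β := b y x' with hβ
  -- Since `[h', x'] = x'`, exponentials of multiples of `h'` rescale `x'` within `S`. Applying `exp
  -- (ε⁻¹ ad y)` to `(ε²/β) x'` yields `y` plus terms that vanish with `ε`.
  have hcurve : ∀ ε : ℂ, ε ≠ 0 → y + (ε / β) • ⁅y, x'⁆ + (ε ^ 2 / β) • x' ∈ S := by
    intro ε hε
    have hc : ε ^ 2 / β ≠ 0 := div_ne_zero (pow_ne_zero 2 hε) hyx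
    have h1 : (ε ^ 2 / β) • x' ∈ S := by
      rw [← Complex.exp_log hc, ← hA.of_lie_eq_smul (Complex.log (ε ^ 2 / β) • h')]
      · exact hS _ _ hx'S
      · rw [smul_lie, hx']
    have h2 := hS (ε⁻¹ • y) _ h1
    rw [hA.apply_smul, hA.of_lie_lie_lie_eq_zero] at h2
    · convert h2 using 1
      simp only [smul_lie, lie_smul, hy x', ← hβ]
      match_scalars <;> field_simp
    · simp [hy x']
  have hlim : Filter.Tendsto (fun ε : ℂ => y + (ε / β) • ⁅y, x'⁆ + (ε ^ 2 / β) • x')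
      (𝓝[≠] 0) (𝓝 y) := by
    have hcont : Continuous fun ε : ℂ => y + (ε / β) • ⁅y, x'⁆ + (ε ^ 2 / β) • x' := by
      fun_prop
    refine Filter.Tendsto.mono_left ?_ nhdsWithin_le_nhds
    simpa using hcont.tendsto 0
  refine mem_closure_of_tendsto hlim ?_
  filter_upwards [self_mem_nhdsWithin] with ε hε using hcurve ε hε

variable (hS : ∀ w, ∀ x ∈ S, A w x ∈ S)
include hS

/-- The first derivative of `β(x, x)` along `exp (t ad w)`. The result is again a bilinear form
vanishing on the diagonal of `S`, so the lemma can be iterated. -/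
lemma vanishing_deriv {β : L →ₗ[ℂ] L →ₗ[ℂ] ℂ} (hβ : ∀ x ∈ S, β x x = 0) (w : L) :
    ∀ x ∈ S, (β ∘ₗ LieAlgebra.ad ℂ L w + β.compl₂ (LieAlgebra.ad ℂ L w)) x x = 0 := by
  intro x hx
  have h1 := hA.hasDerivAt₂ w x x β 0
  have h2 : (fun t : ℂ => β (A (t • w) x) (A (t • w) x)) = fun _ => 0 := by
    ext t
    exact hβ _ (hS _ _ hx)
  rw [h2] at h1
  simpa [hA.zero_apply] using h1.unique (hasDerivAt_const (0 : ℂ) (0 : ℂ))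

/-- A quadratic form that vanishes on a nonempty open piece of the set of extremal elements vanishes
on all of them. -/
lemma vanishing_of_vanishing_open [LieAlgebra.IsSimple ℂ L] (hb : IsInvariantForm b)
    (hnd : ∀ u, (∀ z, b u z = 0) → u = 0) {β : L →ₗ[ℂ] L →ₗ[ℂ] ℂ} (hN : IsOpen N) {x₀ : L}
    (h₀ : x₀ ≠ 0) (hx₀ : IsExtremal b x₀) (hx₀S : x₀ ∈ S) (hx₀N : x₀ ∈ N)
    (hβ : ∀ x ∈ S, x ∈ N → β x x = 0) {x : L} (hx : IsExtremal b x) (hx0 : x ≠ 0) :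
    β x x = 0 := by
  -- Local vanishing propagates along `exp (t ad w)`: the restriction of `β` to such a curve is
  -- entire and zero near `t = 0`, hence zero at `t = 1`.
  have key : ∀ w, ∀ x ∈ {x | x ∈ S ∧ ∃ N : Set L, IsOpen N ∧ x ∈ N ∧ ∀ y ∈ S, y ∈ N → β y y = 0},
      A w x ∈ {x | x ∈ S ∧ ∃ N : Set L, IsOpen N ∧ x ∈ N ∧ ∀ y ∈ S, y ∈ N → β y y = 0} := by
    rintro w x ⟨hxS, N, hN, hxN, h⟩
    refine ⟨hS w x hxS, A (-w) ⁻¹' N, hN.preimage (hA.continuous _), ?_, fun y hyS hyN => ?_⟩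
    · rw [Set.mem_preimage, hA.neg_apply]
      exact hxN
    · have hf : Differentiable ℂ fun t : ℂ => β (A (t • w) (A (-w) y)) (A (t • w) (A (-w) y)) :=
        fun t => (hA.hasDerivAt₂ w _ _ β t).differentiableAt
      have h1 : (fun t : ℂ => β (A (t • w) (A (-w) y)) (A (t • w) (A (-w) y))) =ᶠ[𝓝 0]
          fun _ => 0 := by
        filter_upwards [hA.eventually_mem hS hN (hS (-w) y hyS) hyN w] with t ht
        exact h _ ht.1 ht.2
      have h2 := congrFun (AnalyticOnNhd.eq_of_eventuallyEq
        (hf.differentiableOn.analyticOnNhd isOpen_univ) analyticOnNhd_const h1) 1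
      have h3 : A w (A (-w) y) = y := by simpa using hA.neg_apply (-w) y
      simpa [h3] using h2
  obtain ⟨hxS, N', -, hxN', h⟩ := hA.mem_of_isExtremal key hb hnd hx₀ h₀
    ⟨hx₀S, N, hN, hx₀N, hβ⟩ hx hx0
  exact h x hxS hxN'

end Vanishing

end IsAdExp

end AdExp

/-! ### Differentials of group automorphisms. -/

section DerivOne

variable {E : Type*} [NormedAddCommGroup E] [NormedSpace ℂ E]
  {G : Type*} [TopologicalSpace G] [ChartedSpace E G] [Group G]

/-- The derivative at the identity of a map `G → G` that fixes the identity. -/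
def derivOne (f : G → G) : LieAlg E G →L[ℂ] LieAlg E G := mfderiv 𝓘(ℂ, E) 𝓘(ℂ, E) f 1

lemma derivOne_comp {f g : G → G} (hf : MDifferentiableAt 𝓘(ℂ, E) 𝓘(ℂ, E) f 1)
    (hg : MDifferentiableAt 𝓘(ℂ, E) 𝓘(ℂ, E) g 1) (h1 : f 1 = 1) :
    (derivOne (g ∘ f) : LieAlg E G →L[ℂ] LieAlg E G) = (derivOne g).comp (derivOne f) := by
  have hg' : MDifferentiableAt 𝓘(ℂ, E) 𝓘(ℂ, E) g (f 1) := by rwa [h1]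
  have h2 := mfderiv_comp (I := 𝓘(ℂ, E)) (I' := 𝓘(ℂ, E)) (I'' := 𝓘(ℂ, E)) (1 : G) hg' hf
  have h3 : ∀ a : G, a = 1 → ∀ v : E, (mfderiv 𝓘(ℂ, E) 𝓘(ℂ, E) g a v : E) = derivOne g v := by
    rintro a rfl v
    rfl
  refine ContinuousLinearMap.ext fun v => ?_
  refine (congrArg (fun T : E →L[ℂ] E => T v) h2).trans ?_
  exact h3 (f 1) h1 _

lemma derivOne_id : (derivOne (id : G → G) : LieAlg E G →L[ℂ] LieAlg E G) = .id ℂ _ :=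
  mfderiv_id

lemma Ad_eq_derivOne (g : G) : Ad E g = derivOne fun x : G => g * x * g⁻¹ := rfl

lemma Ad_one : Ad E (1 : G) = .id ℂ _ := by
  rw [Ad_eq_derivOne, ← derivOne_id]
  congr 1
  ext x
  simp

variable [LieGroup 𝓘(ℂ, E) ω G]

lemma contMDiff_conj (g : G) : ContMDiff 𝓘(ℂ, E) 𝓘(ℂ, E) ω fun x : G => g * x * g⁻¹ :=
  (contMDiff_const.mul contMDiff_id).mul contMDiff_const

lemma Ad_mul (g h : G) : Ad E (g * h) = (Ad E g).comp (Ad E h) := by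
  rw [Ad_eq_derivOne, Ad_eq_derivOne, Ad_eq_derivOne, ← derivOne_comp]
  · congr 1
    ext x
    simp [mul_assoc]
  · exact (contMDiff_conj h).contMDiffAt.mdifferentiableAt (by simp)
  · exact (contMDiff_conj g).contMDiffAt.mdifferentiableAt (by simp)
  · simp

lemma Ad_inv_apply (g : G) (x : LieAlg E G) : Ad E g⁻¹ (Ad E g x) = x := by
  have h := Ad_mul (E := E) g⁻¹ g
  rw [inv_mul_cancel, Ad_one] at h
  exact (congrArg (fun T : LieAlg E G →L[ℂ] LieAlg E G => T x) h).symm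

variable [CompleteSpace E]

/-- A smooth automorphism of a Lie group induces an automorphism of the Lie algebra. -/
lemma derivOne_lie {f g : G → G} (hf : ContMDiff 𝓘(ℂ, E) 𝓘(ℂ, E) ω f)
    (hg : ContMDiff 𝓘(ℂ, E) 𝓘(ℂ, E) ω g) (hfg : ∀ x, f (g x) = x) (hgf : ∀ x, g (f x) = x)
    (hmul : ∀ x y, f (x * y) = f x * f y) (v w : LieAlg E G) :
    derivOne f ⁅v, w⁆ = ⁅derivOne f v, derivOne f w⁆ := by
  have hf1 : f 1 = 1 := by simpa using hmul 1 1
  have hd : ∀ x, MDifferentiableAt 𝓘(ℂ, E) 𝓘(ℂ, E) f x := fun x =>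
    hf.contMDiffAt.mdifferentiableAt (by simp)
  have hd' : ∀ x, MDifferentiableAt 𝓘(ℂ, E) 𝓘(ℂ, E) g x := fun x =>
    hg.contMDiffAt.mdifferentiableAt (by simp)
  have hl : ∀ a x : G, MDifferentiableAt 𝓘(ℂ, E) 𝓘(ℂ, E) (fun y : G => a * y) x := fun a x =>
    (contMDiff_mul_left (I := 𝓘(ℂ, E)) (n := ω)).contMDiffAt.mdifferentiableAt (by simp)
  have hinv : ∀ x (u : E), ((mfderiv 𝓘(ℂ, E) 𝓘(ℂ, E) f x).inverse
      ((mfderiv 𝓘(ℂ, E) 𝓘(ℂ, E) f x : E →L[ℂ] E) u) : E) = u ∧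
      (mfderiv 𝓘(ℂ, E) 𝓘(ℂ, E) f x : E →L[ℂ] E)
        ((mfderiv 𝓘(ℂ, E) 𝓘(ℂ, E) f x).inverse u : E) = u := by
    intro x u
    have h1 : ((mfderiv 𝓘(ℂ, E) 𝓘(ℂ, E) g (f x) : E →L[ℂ] E).comp
        (mfderiv 𝓘(ℂ, E) 𝓘(ℂ, E) f x : E →L[ℂ] E)) = .id ℂ E := by
      have h2 := mfderiv_comp (I := 𝓘(ℂ, E)) (I' := 𝓘(ℂ, E)) (I'' := 𝓘(ℂ, E)) x (hd' (f x)) (hd x)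
      rw [show g ∘ f = id from funext hgf, mfderiv_id] at h2
      exact h2.symm
    have h1' : ((mfderiv 𝓘(ℂ, E) 𝓘(ℂ, E) f x : E →L[ℂ] E).comp
        (mfderiv 𝓘(ℂ, E) 𝓘(ℂ, E) g (f x) : E →L[ℂ] E)) = .id ℂ E := by
      have hd'' : MDifferentiableAt 𝓘(ℂ, E) 𝓘(ℂ, E) f (g (f x)) := hd _
      have h2 := mfderiv_comp (I := 𝓘(ℂ, E)) (I' := 𝓘(ℂ, E)) (I'' := 𝓘(ℂ, E)) (f x) hd'' (hd' (f x))
      rw [show f ∘ g = id from funext hfg, mfderiv_id, hgf] at h2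
      exact h2.symm
    have h3 : (mfderiv 𝓘(ℂ, E) 𝓘(ℂ, E) f x : E →L[ℂ] E).inverse =
        (mfderiv 𝓘(ℂ, E) 𝓘(ℂ, E) g (f x) : E →L[ℂ] E) := ContinuousLinearMap.inverse_eq h1' h1
    refine ⟨(congrArg (fun T : E →L[ℂ] E => T ((mfderiv 𝓘(ℂ, E) 𝓘(ℂ, E) f x : E →L[ℂ] E) u)) h3).trans
      (congrArg (fun T : E →L[ℂ] E => T u) h1), ?_⟩
    exact (congrArg (fun T : E →L[ℂ] E => (mfderiv 𝓘(ℂ, E) 𝓘(ℂ, E) f x : E →L[ℂ] E) (T u)) h3).trans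
      (congrArg (fun T : E →L[ℂ] E => T u) h1')
  have hf1' : ∀ a : G, a = 1 → ∀ b c : G, ∀ u : E, b = c →
      (mfderiv 𝓘(ℂ, E) 𝓘(ℂ, E) (fun y : G => b * y) a u : E) =
        mfderiv 𝓘(ℂ, E) 𝓘(ℂ, E) (fun y : G => c * y) 1 u := by
    rintro a rfl b c u rfl
    rfl
  -- As `f` commutes with left translations, it pulls left-invariant fields back to left-invariant
  -- fields; naturality of the bracket of vector fields then gives the claim.
  have hpull : ∀ u : LieAlg E G, VectorField.mpullback 𝓘(ℂ, E) 𝓘(ℂ, E) f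
      (mulInvariantVectorField (derivOne f u)) = mulInvariantVectorField u := by
    intro u
    ext x
    have h1 := mfderiv_comp (I := 𝓘(ℂ, E)) (I' := 𝓘(ℂ, E)) (I'' := 𝓘(ℂ, E)) (1 : G)
      (hl (f x) (f 1)) (hd 1)
    have h2 := mfderiv_comp (I := 𝓘(ℂ, E)) (I' := 𝓘(ℂ, E)) (I'' := 𝓘(ℂ, E)) (1 : G)
      (hd (x * 1)) (hl x 1)
    have h3 : (fun y => f x * y) ∘ f = f ∘ fun y => x * y := by
      ext y
      simp [hmul]
    rw [h3, h2] at h1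
    have h4 : (mulInvariantVectorField (derivOne f u) (f x) : E) =
        (mfderiv 𝓘(ℂ, E) 𝓘(ℂ, E) f x : E →L[ℂ] E) (mulInvariantVectorField u x : E) := by
      have h5 := congrArg (fun T : E →L[ℂ] E => T u) h1
      have h6 : ∀ y : G, y = x → ∀ u : E, (mfderiv 𝓘(ℂ, E) 𝓘(ℂ, E) f y : E →L[ℂ] E) u =
          (mfderiv 𝓘(ℂ, E) 𝓘(ℂ, E) f x : E →L[ℂ] E) u := by
        rintro y rfl u
        rfl
      exact ((hf1' (f 1) hf1 (f x) (f x) _ rfl).symm.trans h5.symm).trans (h6 (x * 1) (mul_one x) _)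
    exact (congrArg (fun z : E => ((mfderiv 𝓘(ℂ, E) 𝓘(ℂ, E) f x).inverse z : E)) h4).trans
      (hinv x _).1
  have h1 := VectorField.mpullback_mlieBracket (I := 𝓘(ℂ, E)) (I' := 𝓘(ℂ, E)) (x₀ := (1 : G))
    (f := f) (n := ω) (V := mulInvariantVectorField (derivOne f v))
    (W := mulInvariantVectorField (derivOne f w)) (mdifferentiableAt_mulInvariantVectorField _)
    (mdifferentiableAt_mulInvariantVectorField _) hf.contMDiffAt (by simp)
  rw [hpull, hpull] at h1
  have h2 : ∀ a : G, a = 1 → (VectorField.mlieBracket 𝓘(ℂ, E)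
      (mulInvariantVectorField (derivOne f v)) (mulInvariantVectorField (derivOne f w)) a : E) =
        ⁅derivOne f v, derivOne f w⁆ := by
    rintro a rfl
    rfl
  refine Eq.trans ?_ (h2 (f 1) hf1)
  refine Eq.trans ?_ (hinv 1 _).2
  exact congrArg (fun z : E => (mfderiv 𝓘(ℂ, E) 𝓘(ℂ, E) f 1 : E →L[ℂ] E) z) h1.symm

end DerivOne

/-! ### The adjoint representation in a chart, and its derivative. -/

section Chart

variable (E : Type*) [NormedAddCommGroup E] [NormedSpace ℂ E]
  (G : Type*) [TopologicalSpace G] [ChartedSpace E G] [Group G]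

/-- The preferred chart at the identity. -/
abbrev chartOne : PartialEquiv G E := extChartAt 𝓘(ℂ, E) (1 : G)

/-- The coordinates of the identity. -/
abbrev coordOne : E := chartOne E G 1

/-- The group multiplication in the chart at the identity. -/
def chartMul (p : E × E) : E :=
  chartOne E G ((chartOne E G).symm p.1 * (chartOne E G).symm p.2)

variable {E G}

lemma chartOne_symm_coordOne : (chartOne E G).symm (coordOne E G) = 1 := extChartAt_to_inv 1

lemma eventually_chartOne_symm_mem :
    ∀ᶠ x in 𝓝 (coordOne E G), (chartOne E G).symm x ∈ (chartOne E G).source := by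
  filter_upwards [extChartAt_target_mem_nhds (I := 𝓘(ℂ, E)) (1 : G)] with x hx
  exact (chartOne E G).map_target hx

lemma eventually_chartOne_right_inv :
    ∀ᶠ x in 𝓝 (coordOne E G), chartOne E G ((chartOne E G).symm x) = x := by
  filter_upwards [extChartAt_target_mem_nhds (I := 𝓘(ℂ, E)) (1 : G)] with x hx
  exact (chartOne E G).right_inv hx

lemma chartMul_left_one : ∀ᶠ x in 𝓝 (coordOne E G), chartMul E G (coordOne E G, x) = x := by
  filter_upwards [eventually_chartOne_right_inv] with x hx
  rw [chartMul, chartOne_symm_coordOne, one_mul, hx]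

lemma chartMul_right_one : ∀ᶠ x in 𝓝 (coordOne E G), chartMul E G (x, coordOne E G) = x := by
  filter_upwards [eventually_chartOne_right_inv] with x hx
  rw [chartMul, chartOne_symm_coordOne, mul_one, hx]

variable (E) in
/-- The adjoint representation as a map into the endomorphisms of the model space. -/
def modelAdjoint (g : G) : E →L[ℂ] E := Ad E g

/-- The adjoint representation in the chart at the identity. -/
def chartAd (x : E) : E →L[ℂ] E := modelAdjoint E ((chartOne E G).symm x)

lemma chartAd_coordOne : chartAd (E := E) (G := G) (coordOne E G) = .id ℂ E := by
  rw [chartAd, chartOne_symm_coordOne, modelAdjoint]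
  exact Ad_one

variable [LieGroup 𝓘(ℂ, E) ω G]

lemma contMDiffAt_chartOne_symm :
    ContMDiffAt 𝓘(ℂ, E) 𝓘(ℂ, E) ω (chartOne E G).symm (coordOne E G) := by
  have : IsManifold 𝓘(ℂ, E) ω G := ContMDiffMul.toIsManifold
  exact (contMDiffOn_extChartAt_symm (1 : G)).contMDiffAt (extChartAt_target_mem_nhds (1 : G))

lemma contMDiffAt_chartOne {x : G} (hx : x ∈ (chartOne E G).source) :
    ContMDiffAt 𝓘(ℂ, E) 𝓘(ℂ, E) ω (chartOne E G) x := by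
  have : IsManifold 𝓘(ℂ, E) ω G := ContMDiffMul.toIsManifold
  refine contMDiffAt_extChartAt' ?_
  rwa [← extChartAt_source 𝓘(ℂ, E)]

lemma hasMFDerivAt_chartOne_symm : HasMFDerivAt 𝓘(ℂ, E) 𝓘(ℂ, E) (chartOne E G).symm
    (coordOne E G) (ContinuousLinearMap.id ℂ E) := by
  have : IsManifold 𝓘(ℂ, E) ω G := ContMDiffMul.toIsManifold
  have : IsManifold 𝓘(ℂ, E) 1 G := IsManifold.of_le (n := ω) le_top
  have h2 := (contMDiffAt_chartOne_symm (E := E) (G := G)).mdifferentiableAt (by simp)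
  have h3 := mfderivWithin_range_extChartAt_symm (I := 𝓘(ℂ, E)) (x := (1 : G))
  rw [ModelWithCorners.range_eq_univ, mfderivWithin_univ] at h3
  have h4 := h2.hasMFDerivAt
  rw [h3] at h4
  exact h4

lemma hasFDerivAt_chart {h : G → G} (hh : MDifferentiableAt 𝓘(ℂ, E) 𝓘(ℂ, E) h 1)
    (hs : h 1 ∈ (chartOne E G).source) :
    HasFDerivAt (fun y => chartOne E G (h ((chartOne E G).symm y)))
      ((mfderiv 𝓘(ℂ, E) 𝓘(ℂ, E) (chartOne E G) (h 1) : E →L[ℂ] E).comp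
        (mfderiv 𝓘(ℂ, E) 𝓘(ℂ, E) h 1 : E →L[ℂ] E)) (coordOne E G) := by
  have h5 : ∀ a : G, a = 1 → HasMFDerivAt 𝓘(ℂ, E) 𝓘(ℂ, E) (chartOne E G ∘ h) a
      ((mfderiv 𝓘(ℂ, E) 𝓘(ℂ, E) (chartOne E G) (h 1) : E →L[ℂ] E).comp
        (mfderiv 𝓘(ℂ, E) 𝓘(ℂ, E) h 1 : E →L[ℂ] E)) := by
    rintro a rfl
    exact ((contMDiffAt_chartOne hs).mdifferentiableAt (by simp)).hasMFDerivAt.comp (1 : G)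
      hh.hasMFDerivAt
  have h6 := (h5 _ chartOne_symm_coordOne).comp (coordOne E G) hasMFDerivAt_chartOne_symm
  rw [hasMFDerivAt_iff_hasFDerivAt] at h6
  exact h6

lemma contDiffAt_chartMul : ContDiffAt ℂ ω (chartMul E G) (coordOne E G, coordOne E G) := by
  have h1 : ContMDiffAt 𝓘(ℂ, E × E) 𝓘(ℂ, E) ω
      (fun p : E × E => (chartOne E G).symm p.1 * (chartOne E G).symm p.2)
      (coordOne E G, coordOne E G) := by
    have ha : ContMDiffAt 𝓘(ℂ, E × E) 𝓘(ℂ, E) ω (fun p : E × E => (chartOne E G).symm p.1)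
        (coordOne E G, coordOne E G) :=
      ContMDiffAt.comp (g := (chartOne E G).symm) (I' := 𝓘(ℂ, E)) (f := Prod.fst)
        (coordOne E G, coordOne E G) contMDiffAt_chartOne_symm contDiff_fst.contMDiff.contMDiffAt
    have hb : ContMDiffAt 𝓘(ℂ, E × E) 𝓘(ℂ, E) ω (fun p : E × E => (chartOne E G).symm p.2)
        (coordOne E G, coordOne E G) :=
      ContMDiffAt.comp (g := (chartOne E G).symm) (I' := 𝓘(ℂ, E)) (f := Prod.snd)
        (coordOne E G, coordOne E G) contMDiffAt_chartOne_symm contDiff_snd.contMDiff.contMDiffAt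
    exact ha.mul hb
  have h2 : ContMDiffAt 𝓘(ℂ, E) 𝓘(ℂ, E) ω (chartOne E G)
      ((chartOne E G).symm (coordOne E G) * (chartOne E G).symm (coordOne E G)) := by
    refine contMDiffAt_chartOne ?_
    rw [chartOne_symm_coordOne, mul_one]
    exact mem_extChartAt_source 1
  have h3 := ContMDiffAt.comp (g := chartOne E G) (coordOne E G, coordOne E G) h2 h1
  exact h3.contDiffAt

variable (G) in
/-- The left-invariant vector fields in the chart at the identity. -/
def chartLeft (x : E) : E →L[ℂ] E :=
  (fderiv ℂ (chartMul E G) (x, coordOne E G)).comp (.inr ℂ E E)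

variable (G) in
/-- The right-invariant vector fields in the chart at the identity. -/
def chartRight (x : E) : E →L[ℂ] E :=
  (fderiv ℂ (chartMul E G) (coordOne E G, x)).comp (.inl ℂ E E)

lemma contDiffAt_fderiv_chartMul :
    ContDiffAt ℂ ω (fderiv ℂ (chartMul E G)) (coordOne E G, coordOne E G) :=
  contDiffAt_chartMul.fderiv_right (m := ω) (by simp)

lemma contDiffAt_chartLeft : ContDiffAt ℂ ω (chartLeft G) (coordOne E G) :=
  (ContDiffAt.comp (g := fderiv ℂ (chartMul E G)) (f := fun x : E => (x, coordOne E G)) (coordOne E G)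
    contDiffAt_fderiv_chartMul (contDiffAt_id.prodMk contDiffAt_const)).clm_comp contDiffAt_const

lemma contDiffAt_chartRight : ContDiffAt ℂ ω (chartRight G) (coordOne E G) :=
  (ContDiffAt.comp (g := fderiv ℂ (chartMul E G)) (f := fun x : E => (coordOne E G, x)) (coordOne E G)
    contDiffAt_fderiv_chartMul (contDiffAt_const.prodMk contDiffAt_id)).clm_comp contDiffAt_const

lemma eventually_differentiableAt_chartMul_left :
    ∀ᶠ x in 𝓝 (coordOne E G), DifferentiableAt ℂ (chartMul E G) (x, coordOne E G) := by
  have h1 : ∀ᶠ p in 𝓝 (coordOne E G, coordOne E G), DifferentiableAt ℂ (chartMul E G) p := by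
    filter_upwards [(contDiffAt_chartMul (E := E) (G := G)).eventually (by simp)] with p hp
    exact hp.differentiableAt (by simp)
  exact (Continuous.prodMk_left (coordOne E G)).continuousAt.eventually h1

lemma eventually_differentiableAt_chartMul_right :
    ∀ᶠ x in 𝓝 (coordOne E G), DifferentiableAt ℂ (chartMul E G) (coordOne E G, x) := by
  have h1 : ∀ᶠ p in 𝓝 (coordOne E G, coordOne E G), DifferentiableAt ℂ (chartMul E G) p := by
    filter_upwards [(contDiffAt_chartMul (E := E) (G := G)).eventually (by simp)] with p hp
    exact hp.differentiableAt (by simp)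
  exact (Continuous.prodMk_right (coordOne E G)).continuousAt.eventually h1

lemma eventually_hasFDerivAt_left : ∀ᶠ x in 𝓝 (coordOne E G),
    HasFDerivAt (fun y => chartMul E G (x, y)) (chartLeft G x) (coordOne E G) := by
  filter_upwards [eventually_differentiableAt_chartMul_left (E := E) (G := G)] with x hx
  exact hx.hasFDerivAt.comp (coordOne E G) (hasFDerivAt_prodMk_right x (coordOne E G))

lemma eventually_hasFDerivAt_right : ∀ᶠ x in 𝓝 (coordOne E G),
    HasFDerivAt (fun y => chartMul E G (y, x)) (chartRight G x) (coordOne E G) := by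
  filter_upwards [eventually_differentiableAt_chartMul_right (E := E) (G := G)] with x hx
  exact HasFDerivAt.comp (g := chartMul E G) (f := fun y => (y, x)) (coordOne E G)
    hx.hasFDerivAt (hasFDerivAt_prodMk_left (coordOne E G) x)

lemma chartLeft_coordOne : chartLeft G (coordOne E G) = .id ℂ E :=
  (eventually_hasFDerivAt_left (E := E) (G := G)).self_of_nhds.unique
    ((hasFDerivAt_id _).congr_of_eventuallyEq chartMul_left_one)

lemma chartRight_coordOne : chartRight G (coordOne E G) = .id ℂ E :=
  (eventually_hasFDerivAt_right (E := E) (G := G)).self_of_nhds.unique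
    ((hasFDerivAt_id _).congr_of_eventuallyEq chartMul_right_one)

lemma eventually_chartLeft_eq : ∀ᶠ x in 𝓝 (coordOne E G), chartLeft G x =
    (mfderiv 𝓘(ℂ, E) 𝓘(ℂ, E) (chartOne E G) ((chartOne E G).symm x) : E →L[ℂ] E).comp
      (mfderiv 𝓘(ℂ, E) 𝓘(ℂ, E) (fun y : G => (chartOne E G).symm x * y) 1 : E →L[ℂ] E) := by
  filter_upwards [eventually_hasFDerivAt_left (E := E) (G := G), eventually_chartOne_symm_mem]
    with x hx hx'
  have h1 := hasFDerivAt_chart (E := E) (h := fun y : G => (chartOne E G).symm x * y)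
    ((contMDiff_mul_left (I := 𝓘(ℂ, E)) (n := ω)).contMDiffAt.mdifferentiableAt (by simp))
    (by simpa using hx')
  rw [mul_one] at h1
  exact hx.unique h1

lemma eventually_chartRight_eq : ∀ᶠ x in 𝓝 (coordOne E G), chartRight G x =
    (mfderiv 𝓘(ℂ, E) 𝓘(ℂ, E) (chartOne E G) ((chartOne E G).symm x) : E →L[ℂ] E).comp
      (mfderiv 𝓘(ℂ, E) 𝓘(ℂ, E) (fun y : G => y * (chartOne E G).symm x) 1 : E →L[ℂ] E) := by
  filter_upwards [eventually_hasFDerivAt_right (E := E) (G := G), eventually_chartOne_symm_mem]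
    with x hx hx'
  have h1 := hasFDerivAt_chart (E := E) (h := fun y : G => y * (chartOne E G).symm x)
    ((contMDiff_mul_right (I := 𝓘(ℂ, E)) (n := ω)).contMDiffAt.mdifferentiableAt (by simp))
    (by simpa using hx')
  rw [one_mul] at h1
  exact hx.unique h1

/-- This is `g y = (g y g⁻¹) g` differentiated at `y = 1`. It lets `Ad` be solved for near the
identity. -/
lemma eventually_chartRight_comp_chartAd : ∀ᶠ x in 𝓝 (coordOne E G),
    (chartRight G x).comp (chartAd (G := G) x) = chartLeft G x := by
  filter_upwards [eventually_chartLeft_eq (E := E) (G := G), eventually_chartRight_eq (E := E) (G := G)]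
    with x hl hr
  rw [hl]
  refine (congrArg (fun T : E →L[ℂ] E => T.comp (chartAd (G := G) x)) hr).trans ?_
  set g := (chartOne E G).symm x with hg
  suffices h : (mfderiv 𝓘(ℂ, E) 𝓘(ℂ, E) (fun y : G => y * g) 1 : E →L[ℂ] E).comp
      (Ad E g : E →L[ℂ] E) = (mfderiv 𝓘(ℂ, E) 𝓘(ℂ, E) (fun y : G => g * y) 1 : E →L[ℂ] E) from
    congrArg (fun T : E →L[ℂ] E =>
      (mfderiv 𝓘(ℂ, E) 𝓘(ℂ, E) (chartOne E G) g : E →L[ℂ] E).comp T) h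
  have h1 : MDifferentiableAt 𝓘(ℂ, E) 𝓘(ℂ, E) (fun y : G => g * y * g⁻¹) 1 :=
    (contMDiff_conj g).contMDiffAt.mdifferentiableAt (by simp)
  have h2 : ∀ a : G, MDifferentiableAt 𝓘(ℂ, E) 𝓘(ℂ, E) (fun y : G => y * g) a := fun a =>
    (contMDiff_mul_right (I := 𝓘(ℂ, E)) (n := ω)).contMDiffAt.mdifferentiableAt (by simp)
  have h3 := mfderiv_comp (I := 𝓘(ℂ, E)) (I' := 𝓘(ℂ, E)) (I'' := 𝓘(ℂ, E)) (1 : G) (h2 _) h1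
  have h4 : ((fun y : G => y * g) ∘ fun y : G => g * y * g⁻¹) = fun y => g * y := by
    ext y
    simp
  rw [h4] at h3
  have h5 : ∀ a : G, a = 1 → (mfderiv 𝓘(ℂ, E) 𝓘(ℂ, E) (fun y : G => y * g) a : E →L[ℂ] E) =
      (mfderiv 𝓘(ℂ, E) 𝓘(ℂ, E) (fun y : G => y * g) 1 : E →L[ℂ] E) := by
    rintro a rfl
    rfl
  refine Eq.trans ?_ h3.symm
  exact congrArg (fun T : E →L[ℂ] E => T.comp (Ad E g : E →L[ℂ] E))
    (h5 (g * 1 * g⁻¹) (by simp)).symm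

/-- The right-invariant frame is the identity at the base point, hence invertible nearby, so `Ad =
R⁻¹ L` inherits analyticity from the multiplication. -/
lemma contDiffAt_chartAd [CompleteSpace E] :
    ContDiffAt ℂ ω (chartAd (E := E) (G := G)) (coordOne E G) := by
  have h0 : (chartRight G (coordOne E G)) = ((ContinuousLinearEquiv.refl ℂ E : E ≃L[ℂ] E) : E →L[ℂ] E) := by
    rw [chartRight_coordOne]; rfl
  have h1 : ContDiffAt ℂ ω (fun x : E => (chartRight G x).inverse) (coordOne E G) := by
    refine ContDiffAt.comp (g := ContinuousLinearMap.inverse) (coordOne E G) ?_ contDiffAt_chartRight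
    rw [h0]
    exact contDiffAt_map_inverse _
  refine (h1.clm_comp contDiffAt_chartLeft).congr_of_eventuallyEq ?_
  have h2 : ∀ᶠ x in 𝓝 (coordOne E G), (chartRight G x).IsInvertible := by
    have h3 : ∀ᶠ T in 𝓝 (chartRight G (coordOne E G)), T.IsInvertible := by
      rw [h0]
      exact ContinuousLinearEquiv.nhds (ContinuousLinearEquiv.refl ℂ E)
    exact (contDiffAt_chartRight (E := E) (G := G)).continuousAt.eventually h3
  filter_upwards [h2, eventually_chartRight_comp_chartAd (E := E) (G := G)] with x hx hx'
  rw [← hx', ← ContinuousLinearMap.comp_assoc, hx.inverse_comp_self, ContinuousLinearMap.id_comp]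

variable (G) in
/-- The second derivative of the multiplication at the identity. -/
def chartMul₂ : E × E →L[ℂ] E × E →L[ℂ] E :=
  fderiv ℂ (fderiv ℂ (chartMul E G)) (coordOne E G, coordOne E G)

lemma hasFDerivAt_fderiv_chartMul : HasFDerivAt (fderiv ℂ (chartMul E G)) (chartMul₂ G)
    (coordOne E G, coordOne E G) :=
  ((contDiffAt_fderiv_chartMul (E := E) (G := G)).differentiableAt (by simp)).hasFDerivAt

lemma fderiv_chartLeft_apply (v w : E) :
    fderiv ℂ (fun x => chartLeft G x v) (coordOne E G) w = chartMul₂ G (w, 0) (0, v) := by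
  have h1 : HasFDerivAt (fun x : E => fderiv ℂ (chartMul E G) (x, coordOne E G))
      ((chartMul₂ G).comp (.inl ℂ E E)) (coordOne E G) :=
    HasFDerivAt.comp (g := fderiv ℂ (chartMul E G)) (f := fun x => (x, coordOne E G)) (coordOne E G)
      hasFDerivAt_fderiv_chartMul (hasFDerivAt_prodMk_left _ _)
  have h2 := h1.clm_apply (hasFDerivAt_const (𝕜 := ℂ) ((0, v) : E × E) (coordOne E G))
  have h3 : (fun x : E => chartLeft G x v) =
      fun x => fderiv ℂ (chartMul E G) (x, coordOne E G) (0, v) := rfl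
  rw [h3, h2.fderiv]
  simp

lemma fderiv_chartRight_apply (v w : E) :
    fderiv ℂ (fun x => chartRight G x v) (coordOne E G) w = chartMul₂ G (v, 0) (0, w) := by
  have h1 : HasFDerivAt (fun x : E => fderiv ℂ (chartMul E G) (coordOne E G, x))
      ((chartMul₂ G).comp (.inr ℂ E E)) (coordOne E G) :=
    HasFDerivAt.comp (g := fderiv ℂ (chartMul E G)) (f := fun x => (coordOne E G, x)) (coordOne E G)
      hasFDerivAt_fderiv_chartMul (hasFDerivAt_prodMk_right _ _)
  have h2 := h1.clm_apply (hasFDerivAt_const ((v, 0) : E × E) (coordOne E G))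
  have h3 : (fun x : E => chartRight G x v) =
      fun x => fderiv ℂ (chartMul E G) (coordOne E G, x) (v, 0) := rfl
  have h4 : IsSymmSndFDerivAt ℂ (chartMul E G) (coordOne E G, coordOne E G) :=
    contDiffAt_chartMul.isSymmSndFDerivAt (by simp)
  rw [h3, h2.fderiv]
  simpa [chartMul₂] using h4.eq (0, w) (v, 0)

/-- Differentiate `R(x) Ad(x) w = L(x) w` at the identity, where both `R` and `Ad` are the identity
map. -/
lemma fderiv_chartAd_apply [CompleteSpace E] (v w : E) :
    fderiv ℂ (chartAd (E := E) (G := G)) (coordOne E G) v w =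
      chartMul₂ G (v, 0) (0, w) - chartMul₂ G (w, 0) (0, v) := by
  have h1 : HasFDerivAt (fun x => chartAd (E := E) (G := G) x w)
      ((fderiv ℂ (chartAd (E := E) (G := G)) (coordOne E G)).flip w) (coordOne E G) := by
    have h2 := (contDiffAt_chartAd (E := E) (G := G)).differentiableAt (by simp) |>.hasFDerivAt
    have h3 := h2.clm_apply (hasFDerivAt_const w (coordOne E G))
    convert h3 using 1
    ext; simp
  have h4 := (contDiffAt_chartRight (E := E) (G := G)).differentiableAt (by simp)
  have h5 := h4.hasFDerivAt.clm_apply h1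
  have h6 : (fun x => chartRight G x (chartAd (E := E) (G := G) x w)) =ᶠ[𝓝 (coordOne E G)]
      fun x => chartLeft G x w := by
    filter_upwards [eventually_chartRight_comp_chartAd (E := E) (G := G)] with x hx
    rw [← hx]
    rfl
  have h7 := h6.fderiv_eq (𝕜 := ℂ)
  rw [h5.fderiv] at h7
  have h8 := congrArg (fun T : E →L[ℂ] E => T v) h7
  have h9 : fderiv ℂ (chartRight G) (coordOne E G) v w = chartMul₂ G (w, 0) (0, v) := by
    rw [← fderiv_chartRight_apply, fderiv_clm_apply h4 (differentiableAt_const _)]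
    simp
  simp only [fderiv_chartLeft_apply] at h8
  rw [← h8, eq_sub_iff_add_eq]
  simp [chartAd_coordOne, chartRight_coordOne, h9]

variable (G) in
/-- The Lie bracket of the Lie algebra of `G`, as an operation on the model space. -/
def modelLie (v w : E) : E := Bracket.bracket (L := LieAlg E G) (M := LieAlg E G) v w

/-- The bracket of the left-invariant fields read in the chart, whose derivative at the identity is
trivial. This matches the derivative of `Ad` term by term. -/
lemma modelLie_eq (v w : E) :
    modelLie G v w = chartMul₂ G (v, 0) (0, w) - chartMul₂ G (w, 0) (0, v) := by
  have : IsManifold 𝓘(ℂ, E) ω G := ContMDiffMul.toIsManifold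
  have : IsManifold 𝓘(ℂ, E) 1 G := IsManifold.of_le (n := ω) le_top
  have hV : ∀ u : E, (VectorField.mpullbackWithin 𝓘(ℂ, E) 𝓘(ℂ, E) (chartOne E G).symm
      (mulInvariantVectorField (I := 𝓘(ℂ, E)) (G := G) u) Set.univ : E → E) =ᶠ[𝓝 (coordOne E G)]
        fun x => chartLeft G x u := by
    intro u
    filter_upwards [eventually_chartLeft_eq (E := E) (G := G),
      extChartAt_target_mem_nhds (I := 𝓘(ℂ, E)) (1 : G)] with x hx hx'
    rw [hx]
    have h1 := mfderiv_extChartAt_comp_mfderivWithin_extChartAt_symm (I := 𝓘(ℂ, E)) hx'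
    have h2 := mfderivWithin_extChartAt_symm_comp_mfderiv_extChartAt (I := 𝓘(ℂ, E)) hx'
    rw [ModelWithCorners.range_eq_univ] at h1 h2
    have h3 : (mfderivWithin 𝓘(ℂ, E) 𝓘(ℂ, E) (chartOne E G).symm Set.univ x : E →L[ℂ] E).inverse =
        (mfderiv 𝓘(ℂ, E) 𝓘(ℂ, E) (chartOne E G) ((chartOne E G).symm x) : E →L[ℂ] E) :=
      ContinuousLinearMap.inverse_eq h2 h1
    exact congrArg (fun T : E →L[ℂ] E =>
      T (mulInvariantVectorField (I := 𝓘(ℂ, E)) (G := G) u ((chartOne E G).symm x) : E)) h3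
  have h1 := mfderiv_extChartAt_self (I := 𝓘(ℂ, E)) (x := (1 : G))
  have h2 : modelLie G v w = VectorField.lieBracket ℂ (fun x => chartLeft G x v)
      (fun x => chartLeft G x w) (coordOne E G) := by
    refine (congrArg (fun T : E →L[ℂ] E => T.inverse (VectorField.lieBracketWithin ℂ
      (VectorField.mpullbackWithin 𝓘(ℂ, E) 𝓘(ℂ, E) (chartOne E G).symm
        (mulInvariantVectorField (I := 𝓘(ℂ, E)) (G := G) v) (Set.range 𝓘(ℂ, E)))
      (VectorField.mpullbackWithin 𝓘(ℂ, E) 𝓘(ℂ, E) (chartOne E G).symm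
        (mulInvariantVectorField (I := 𝓘(ℂ, E)) (G := G) w) (Set.range 𝓘(ℂ, E)))
      ((chartOne E G).symm ⁻¹' Set.univ ∩ Set.range 𝓘(ℂ, E)) (coordOne E G))) h1).trans ?_
    refine (congrArg (fun T : E →L[ℂ] E => T _) ContinuousLinearMap.inverse_id).trans ?_
    rw [ModelWithCorners.range_eq_univ, Set.preimage_univ, Set.univ_inter]
    refine (congrFun (VectorField.lieBracketWithin_univ (𝕜 := ℂ) (E := E)) (coordOne E G)).trans ?_
    exact (hV v).lieBracket_vectorField_eq (hV w)
  refine h2.trans ?_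
  rw [VectorField.lieBracket, fderiv_chartLeft_apply, fderiv_chartLeft_apply, chartLeft_coordOne]
  rfl

/-- The derivative of the adjoint representation is the bracket. -/
lemma fderiv_chartAd_eq_lie [CompleteSpace E] (v w : E) :
    fderiv ℂ (chartAd (E := E) (G := G)) (coordOne E G) v w = modelLie G v w := by
  rw [modelLie_eq, fderiv_chartAd_apply]

end Chart

/-! ### Exponentials of `ad v` as adjoint actions of group elements. -/

lemma exp_neg_mul_exp {𝔸 : Type*} [NormedRing 𝔸] [NormedAlgebra ℂ 𝔸] [CompleteSpace 𝔸] (T : 𝔸) :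
    NormedSpace.exp (-T) * NormedSpace.exp T = 1 := by
  let _ : NormedAlgebra ℚ 𝔸 := .restrictScalars ℚ ℂ _
  rw [← NormedSpace.exp_add_of_commute (Commute.neg_left (Commute.refl T)), neg_add_cancel,
    NormedSpace.exp_zero]

section AdjointExponential

variable {E : Type*} [NormedAddCommGroup E] [NormedSpace ℂ E]
  {G : Type*} [TopologicalSpace G] [ChartedSpace E G] [Group G]

variable (G) in
/-- The adjoint representation of the Lie algebra of `G` on the model space. -/
def modelAd (v : E) : E →L[ℂ] E := fderiv ℂ (chartAd (E := E) (G := G)) (coordOne E G) v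

variable [CompleteSpace E] [LieGroup 𝓘(ℂ, E) ω G]

/-- Differentiating `Ad(x y) = Ad(x) Ad(y)` at `y = 1` gives the differential equation of `Ad` along
left-invariant fields. -/
lemma eventually_fderiv_chartAd (v : E) : ∀ᶠ x in 𝓝 (coordOne E G),
    HasFDerivAt (chartAd (E := E) (G := G)) (fderiv ℂ (chartAd (E := E) (G := G)) x) x ∧
      fderiv ℂ (chartAd (E := E) (G := G)) x (chartLeft G x v) =
        (chartAd (G := G) x).comp (modelAd G v) := by
  have h1 : ∀ᶠ x in 𝓝 (coordOne E G), DifferentiableAt ℂ (chartAd (E := E) (G := G)) x := by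
    filter_upwards [(contDiffAt_chartAd (E := E) (G := G)).eventually (by simp)] with x hx
    exact hx.differentiableAt (by simp)
  filter_upwards [h1, eventually_hasFDerivAt_left (E := E) (G := G),
    chartMul_right_one (E := E) (G := G), eventually_chartOne_symm_mem (E := E) (G := G)]
    with x hx hl hx1 hxs
  refine ⟨hx.hasFDerivAt, ?_⟩
  have h2 : (fun y => chartAd (G := G) (chartMul E G (x, y))) =ᶠ[𝓝 (coordOne E G)]
      fun y => (chartAd (G := G) x).comp (chartAd (G := G) y) := by
    have h3 : ContinuousAt (fun y => (chartOne E G).symm x * (chartOne E G).symm y)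
        (coordOne E G) := by
      have : ContinuousMul G := continuousMul_of_contMDiffMul 𝓘(ℂ, E) ω
      exact continuousAt_const.mul (contMDiffAt_chartOne_symm (E := E) (G := G)).continuousAt
    have h4 : (chartOne E G).source ∈
        𝓝 ((chartOne E G).symm x * (chartOne E G).symm (coordOne E G)) := by
      rw [chartOne_symm_coordOne, mul_one]
      exact (isOpen_extChartAt_source (1 : G)).mem_nhds hxs
    filter_upwards [h3.eventually h4] with y hy
    rw [chartAd, chartMul, (chartOne E G).left_inv hy]
    exact Ad_mul _ _
  have h5 : HasFDerivAt (chartAd (E := E) (G := G)) (fderiv ℂ (chartAd (E := E) (G := G)) x)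
      (chartMul E G (x, coordOne E G)) := by
    rw [hx1]
    exact hx.hasFDerivAt
  have h6 := h5.comp (coordOne E G) hl
  have h7 := ((contDiffAt_chartAd (E := E) (G := G)).differentiableAt (by simp)).hasFDerivAt
  have h8 := (hasFDerivAt_const (𝕜 := ℂ) (chartAd (G := G) x) (coordOne E G)).clm_comp h7
  have h9 := h6.unique (h8.congr_of_eventuallyEq h2)
  have h10 := congrArg (fun T : E →L[ℂ] E →L[ℂ] E => T v) h9
  simpa [modelAd] using h10

/-- Along an integral curve `α` of the left-invariant field of `v`, the product `Ad(α(t)) exp(-t ad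
v)` has zero derivative. -/
lemma exists_Ad_eq_exp_small (v : E) : ∃ ε > (0 : ℝ), ∀ t : ℝ, |t| < ε →
    ∃ g : G, modelAdjoint E g = NormedSpace.exp (t • modelAd G v) := by
  have hf : ContDiffAt ℝ 1 (fun x => chartLeft G x v) (coordOne E G) := by
    have h1 : ContDiffAt ℂ ω (fun x => chartLeft G x v) (coordOne E G) :=
      (contDiffAt_chartLeft (E := E) (G := G)).clm_apply contDiffAt_const
    exact (h1.restrict_scalars ℝ).of_le le_top
  obtain ⟨α, hα0, ε, hε, hα⟩ :=
    hf.exists_forall_mem_closedBall_exists_eq_forall_mem_Ioo_hasDerivAt₀ 0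
  rw [zero_sub, zero_add] at hα
  have hcont : ContinuousAt α 0 := (hα 0 ⟨by linarith, hε⟩).continuousAt
  have h1 := (eventually_fderiv_chartAd (E := E) (G := G) v)
  rw [← hα0] at h1
  obtain ⟨δ, hδ, h2⟩ := Metric.eventually_nhds_iff.mp (hcont.eventually h1)
  refine ⟨min ε δ, lt_min hε hδ, ?_⟩
  set T := modelAd G v with hT
  have hderiv : ∀ t ∈ Metric.ball (0 : ℝ) (min ε δ), HasDerivAt
      (fun t : ℝ => (chartAd (G := G) (α t)).comp (NormedSpace.exp (t • (-T)))) 0 t := by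
    intro t ht
    rw [mem_ball_zero_iff, Real.norm_eq_abs, lt_min_iff] at ht
    obtain ⟨h3, h4⟩ := h2 (y := t) (by simpa using ht.2)
    have h5 : HasDerivAt (fun t => chartAd (G := G) (α t)) ((chartAd (G := G) (α t)).comp T) t := by
      rw [← h4]
      exact (h3.restrictScalars ℝ).comp_hasDerivAt t (hα t (abs_lt.mp ht.1))
    have h6 : HasDerivAt (fun t : ℝ => NormedSpace.exp (t • (-T)))
        ((-T) * NormedSpace.exp (t • (-T))) t := hasDerivAt_exp_smul_const' (-T) t
    have h7 := HasDerivAt.mul (𝔸 := E →L[ℂ] E) h5 h6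
    have h8 : ((chartAd (G := G) (α t)).comp T) * NormedSpace.exp (t • (-T)) +
        chartAd (G := G) (α t) * (-T * NormedSpace.exp (t • (-T))) = 0 := by
      change (chartAd (G := G) (α t) * T) * NormedSpace.exp (t • (-T)) + _ = 0
      noncomm_ring
    rw [h8] at h7
    exact h7
  intro t ht
  have ht' : t ∈ Metric.ball (0 : ℝ) (min ε δ) := by simpa using ht
  have h0' : (0 : ℝ) ∈ Metric.ball (0 : ℝ) (min ε δ) := by simp [hε, hδ]
  have h3 := (convex_ball (0 : ℝ) (min ε δ)).is_const_of_fderivWithin_eq_zero (𝕜 := ℝ)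
    (f := fun t : ℝ => (chartAd (G := G) (α t)).comp (NormedSpace.exp (t • (-T))))
    (fun t ht => (hderiv t ht).differentiableAt.differentiableWithinAt)
    (fun t ht => by
      rw [fderivWithin_of_isOpen Metric.isOpen_ball ht]
      exact ContinuousLinearMap.ext_ring (by simpa using (hderiv t ht).deriv)) ht' h0'
  refine ⟨(chartOne E G).symm (α t), ?_⟩
  have h4 : (chartAd (G := G) (α t)) * (NormedSpace.exp (t • (-T))) = 1 := by
    refine h3.trans ?_
    rw [hα0, chartAd_coordOne, zero_smul, NormedSpace.exp_zero]
    rfl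
  have h5 : NormedSpace.exp (t • (-T)) * NormedSpace.exp (t • T) = (1 : E →L[ℂ] E) := by
    rw [smul_neg]
    exact exp_neg_mul_exp _
  calc chartAd (G := G) (α t) = chartAd (G := G) (α t) *
        (NormedSpace.exp (t • (-T)) * NormedSpace.exp (t • T)) := by rw [h5, mul_one]
    _ = NormedSpace.exp (t • T) := by rw [← mul_assoc, h4, one_mul]

/-- The exponential of `ad v` is the adjoint action of some element of the group. -/
lemma exists_Ad_eq_exp (v : E) : ∃ g : G, modelAdjoint E g = NormedSpace.exp (modelAd G v) := by
  obtain ⟨ε, hε, h⟩ := exists_Ad_eq_exp_small (G := G) v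
  -- The local flow reaches time `1/n`; the `n`-th power of the group element found there does the
  -- rest.
  obtain ⟨n, hn⟩ := exists_nat_gt (1 / ε)
  have hn0 : (0 : ℝ) < n := lt_trans (by positivity) hn
  obtain ⟨g, hg⟩ := h (1 / n) (by
    rw [abs_of_pos (by positivity), div_lt_iff₀ hn0]
    rwa [div_lt_iff₀ hε, mul_comm] at hn)
  refine ⟨g ^ n, ?_⟩
  have h1 : ∀ k : ℕ, modelAdjoint E (g ^ k) = modelAdjoint E g ^ k := by
    intro k
    induction k with
    | zero => rw [pow_zero, pow_zero]; exact Ad_one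
    | succ k ih => rw [pow_succ, pow_succ, ← ih]; exact Ad_mul _ _
  let _ : NormedAlgebra ℚ (E →L[ℂ] E) := .restrictScalars ℚ ℂ _
  rw [h1, hg, ← NormedSpace.exp_nsmul, ← Nat.cast_smul_eq_nsmul ℝ, smul_smul,
    mul_one_div_cancel hn0.ne', one_smul]

end AdjointExponential

/-! ### Evaluation of operator exponentials and the resulting `IsAdExp`. -/

section BanachExponential

variable {E : Type*} [NormedAddCommGroup E] [NormedSpace ℂ E] [CompleteSpace E]

lemma hasSum_exp_apply (T : E →L[ℂ] E) (x : E) :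
    HasSum (fun n : ℕ => ((n.factorial : ℂ)⁻¹) • (T ^ n) x) (NormedSpace.exp T x) :=
  (NormedSpace.exp_series_hasSum_exp' (𝕂 := ℂ) T).mapL (ContinuousLinearMap.apply ℂ E x)

lemma exp_apply_of_nilpotent {T : E →L[ℂ] E} {x : E} (h : T (T (T x)) = 0) :
    NormedSpace.exp T x = x + T x + (2⁻¹ : ℂ) • T (T x) := by
  have h1 : ∀ n ∉ Finset.range 3, ((n.factorial : ℂ)⁻¹) • (T ^ n) x = 0 := by
    intro n hn
    obtain ⟨k, rfl⟩ := Nat.exists_eq_add_of_le' (not_lt.mp (by simpa using hn) : 3 ≤ n)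
    have h2 : (T ^ (k + 3)) x = (T ^ k) (T (T (T x))) := by
      rw [pow_add]
      rfl
    rw [h2, h, map_zero, smul_zero]
  rw [(hasSum_exp_apply T x).unique (hasSum_sum_of_ne_finset_zero h1)]
  simp [Finset.sum_range_succ]

lemma exp_apply_of_eq_smul {T : E →L[ℂ] E} {x : E} {c : ℂ} (h : T x = c • x) :
    NormedSpace.exp T x = Complex.exp c • x := by
  have h1 : ∀ n : ℕ, (T ^ n) x = c ^ n • x := by
    intro n
    induction n with
    | zero => simp
    | succ n ih => rw [pow_succ', mul_apply_eq_comp, ih, map_smul, h, smul_smul, pow_succ]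
  have h2 := (NormedSpace.exp_series_hasSum_exp' (𝕂 := ℂ) c).smul_const x
  rw [← Complex.exp_eq_exp_ℂ] at h2
  refine (hasSum_exp_apply T x).unique ?_
  convert h2 using 2 with n
  rw [h1, smul_smul, smul_eq_mul]

lemma hasDerivAt_exp_smul_apply (T : E →L[ℂ] E) (x : E) (t : ℂ) :
    HasDerivAt (fun t : ℂ => NormedSpace.exp (t • T) x) (NormedSpace.exp (t • T) (T x)) t := by
  have h := hasDerivAt_exp_smul_const T t
  have h1 := h.clm_apply (hasDerivAt_const t x)
  simpa using h1

end BanachExponential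

section LieAlgExponential

variable {E : Type*} [NormedAddCommGroup E] [NormedSpace ℂ E]
  {G : Type*} [TopologicalSpace G] [ChartedSpace E G] [Group G]

lemma modelAd_smul (t : ℂ) (v : E) : modelAd G (t • v) = t • modelAd G v := by
  simp [modelAd]

lemma modelAd_neg (v : E) : modelAd G (-v) = -modelAd G v := by
  simp [modelAd]

variable [CompleteSpace E]

lemma exp_modelAd_neg_apply (w x : E) :
    NormedSpace.exp (modelAd G (-w)) (NormedSpace.exp (modelAd G w) x) = x := by
  have h1 := exp_neg_mul_exp (modelAd G w)
  rw [← modelAd_neg] at h1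
  exact congrArg (fun T : E →L[ℂ] E => T x) h1

variable [LieGroup 𝓘(ℂ, E) ω G]

lemma modelAd_apply (v w : E) : modelAd G v w = modelLie G v w := fderiv_chartAd_eq_lie v w

lemma hasDerivAt_exp_modelAd (w x : E) (t : ℂ) :
    HasDerivAt (fun t : ℂ => NormedSpace.exp (modelAd G (t • w)) x)
      (NormedSpace.exp (modelAd G (t • w)) (modelLie G w x)) t := by
  have h := hasDerivAt_exp_smul_apply (modelAd G w) x t
  simp_rw [← modelAd_smul, modelAd_apply] at h
  exact h

lemma exp_modelAd_of_nilpotent {w x : E} (h : modelLie G w (modelLie G w (modelLie G w x)) = 0) :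
    NormedSpace.exp (modelAd G w) x =
      x + modelLie G w x + (2⁻¹ : ℂ) • modelLie G w (modelLie G w x) := by
  simp_rw [← modelAd_apply] at h ⊢
  exact exp_apply_of_nilpotent h

lemma exp_modelAd_of_eq_smul {w x : E} {c : ℂ} (h : modelLie G w x = c • x) :
    NormedSpace.exp (modelAd G w) x = Complex.exp c • x := by
  rw [← modelAd_apply] at h
  exact exp_apply_of_eq_smul h

/-- The exponential of the adjoint representation, as an operation on the Lie algebra. -/
def expAd (w x : LieAlg E G) : LieAlg E G := NormedSpace.exp (modelAd (E := E) G w) x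

lemma exists_Ad_eq_expAd (w : LieAlg E G) : ∃ g : G, ∀ x, Ad E g x = expAd w x := by
  obtain ⟨g, hg⟩ := exists_Ad_eq_exp (E := E) (G := G) w
  exact ⟨g, fun x => congrArg (fun T : E →L[ℂ] E => T x) hg⟩

lemma Ad_lie (g : G) (x y : LieAlg E G) : Ad E g ⁅x, y⁆ = ⁅Ad E g x, Ad E g y⁆ := by
  rw [Ad_eq_derivOne]
  refine derivOne_lie (g := fun x => g⁻¹ * x * g) (contMDiff_conj g) ?_ ?_ ?_ ?_ x y
  · simpa using contMDiff_conj (E := E) g⁻¹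
  · intro x; group
  · intro x; group
  · intro x y; group

lemma isAdExp_expAd [FiniteDimensional ℂ E] :
    IsAdExp (expAd : LieAlg E G → LieAlg E G → LieAlg E G) where
  neg_apply w x := exp_modelAd_neg_apply (E := E) (G := G) w x
  apply_smul w c x := ContinuousLinearMap.map_smul (NormedSpace.exp (modelAd (E := E) G w)) c x
  -- Compatibility with the bracket comes from the group: `exp (ad w)` equals some `Ad g`.
  lie w x y := by
    obtain ⟨g, hg⟩ := exists_Ad_eq_expAd w
    rw [← hg, ← hg, ← hg, Ad_lie]
  continuous w := ContinuousLinearMap.continuous (NormedSpace.exp (modelAd (E := E) G w))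
  continuous_smul w x := continuous_iff_continuousAt.mpr fun t =>
    (hasDerivAt_exp_modelAd (E := E) (G := G) w x t).continuousAt
  hasDerivAt w x φ t := by
    let φ' : E →L[ℂ] ℂ := LinearMap.toContinuousLinearMap (show E →ₗ[ℂ] ℂ from φ)
    exact φ'.hasFDerivAt.comp_hasDerivAt t (hasDerivAt_exp_modelAd (E := E) (G := G) w x t)
  hasDerivAt₂ w x y β t := by
    let B : E →L[ℂ] E →L[ℂ] ℂ := LinearMap.toContinuousLinearMap
      ((LinearMap.toContinuousLinearMap : (E →ₗ[ℂ] ℂ) ≃ₗ[ℂ] E →L[ℂ] ℂ).toLinearMap ∘ₗ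
        (show E →ₗ[ℂ] E →ₗ[ℂ] ℂ from β))
    exact (B.hasFDerivAt.comp_hasDerivAt t (hasDerivAt_exp_modelAd (E := E) (G := G) w x t)).clm_apply
      (hasDerivAt_exp_modelAd (E := E) (G := G) w y t)
  of_lie_lie_lie_eq_zero w x h := exp_modelAd_of_nilpotent (E := E) (G := G) h
  of_lie_eq_smul w x c h := exp_modelAd_of_eq_smul (E := E) (G := G) h

end LieAlgExponential

/-! ### Fixed points of involutions and the Lie algebra of `K`. -/

section LocalInvolution

variable {E : Type*} [NormedAddCommGroup E] [NormedSpace ℂ E] [CompleteSpace E]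

/-- The fixed points of a local holomorphic involution contain a curve in every direction that is
fixed by its derivative. -/
lemma exists_curve_of_involution {f : E → E} {e : E} {D : E →L[ℂ] E} (hf : ContDiffAt ℂ ω f e)
    (he : f e = e) (hD : HasFDerivAt f D e) (hff : ∀ᶠ x in 𝓝 e, f (f x) = x) {v : E}
    (hv : D v = v) : ∃ δ : ℂ → E, δ 0 = e ∧ ContDiffAt ℂ ω δ 0 ∧ HasDerivAt δ v 0 ∧
      ∀ᶠ z in 𝓝 0, f (δ z) = δ z := by
  have hDD : D.comp D = .id ℂ E := by
    have h1 : HasFDerivAt f D (f e) := by rwa [he]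
    exact (h1.comp e hD).unique ((hasFDerivAt_id e).congr_of_eventuallyEq hff)
  have hDD' : ∀ x, D (D x) = x := fun x => congrArg (fun T : E →L[ℂ] E => T x) hDD
  -- Averaging linearizes the involution: `F ∘ f = D ∘ F` near `e`, and `F` has derivative the
  -- identity there. Hence `F⁻¹` carries the line through the fixed vector `v` to a curve of fixed
  -- points.
  set F : E → E := fun x => (2⁻¹ : ℂ) • ((x - e) + D (f x - e)) with hF
  have hF0 : F e = 0 := by simp [hF, he]
  have hFc : ContDiffAt ℂ ω F e := by
    have h1 : ContDiffAt ℂ ω (fun x => D (f x - e)) e :=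
      D.contDiff.contDiffAt.comp e (hf.sub contDiffAt_const)
    exact ((contDiffAt_id.sub contDiffAt_const).add h1).const_smul _
  have hFd : HasFDerivAt F ((ContinuousLinearEquiv.refl ℂ E : E ≃L[ℂ] E) : E →L[ℂ] E) e := by
    have h1 : HasFDerivAt (fun x => D (f x - e)) (D.comp D) e :=
      D.hasFDerivAt.comp e (hD.sub_const e)
    have h2 := (((hasFDerivAt_id e).sub_const e).add h1).const_smul (2⁻¹ : ℂ)
    refine h2.congr_fderiv ?_
    rw [hDD]
    ext x
    change (2⁻¹ : ℂ) • (x + x) = x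
    module
  have hFs := hFc.hasStrictFDerivAt' hFd (by simp)
  set R := hFs.toOpenPartialHomeomorph F with hR
  have heR : e ∈ R.source := hFs.mem_toOpenPartialHomeomorph_source
  have h0R : (0 : E) ∈ R.target := hF0 ▸ hFs.image_mem_toOpenPartialHomeomorph_target
  have hRF : ∀ x, R x = F x := fun _ => rfl
  have hsymm0 : R.symm 0 = e := by rw [← hF0, ← hRF, R.left_inv heR]
  have hsc : ContDiffAt ℂ ω R.symm 0 := by
    refine R.contDiffAt_symm h0R (f₀' := ContinuousLinearEquiv.refl ℂ E) ?_ ?_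
    · rw [hsymm0]; exact hFd
    · rw [hsymm0]; exact hFc
  have hsd : HasFDerivAt R.symm
      (((ContinuousLinearEquiv.refl ℂ E).symm : E ≃L[ℂ] E) : E →L[ℂ] E) 0 :=
    R.hasFDerivAt_symm h0R (by rw [hsymm0]; exact hFd)
  have hline : ContDiffAt ℂ ω (fun z : ℂ => z • v) 0 := contDiffAt_id.smul contDiffAt_const
  have hlineD : HasDerivAt (fun z : ℂ => z • v) v 0 := by
    simpa using (hasDerivAt_id (0 : ℂ)).smul_const v
  have hline0 : (0 : ℂ) • v = 0 := zero_smul ℂ v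
  have hδc : ContDiffAt ℂ ω (fun z : ℂ => R.symm (z • v)) 0 :=
    ContDiffAt.comp (g := R.symm) (0 : ℂ) (by rwa [hline0]) hline
  have hδ0 : R.symm ((0 : ℂ) • v) = e := by rw [hline0, hsymm0]
  refine ⟨fun z => R.symm (z • v), hδ0, hδc, ?_, ?_⟩
  · have h1 : HasFDerivAt R.symm
      (((ContinuousLinearEquiv.refl ℂ E).symm : E ≃L[ℂ] E) : E →L[ℂ] E) ((0 : ℂ) • v) := by
      rwa [hline0]
    exact h1.comp_hasDerivAt (0 : ℂ) hlineD
  · have hδt : Filter.Tendsto (fun z : ℂ => R.symm (z • v)) (𝓝 0) (𝓝 e) := by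
      have := hδc.continuousAt.tendsto
      rwa [hδ0] at this
    have hft : Filter.Tendsto f (𝓝 e) (𝓝 e) := by
      have := hf.continuousAt.tendsto
      rwa [he] at this
    have hlt : Filter.Tendsto (fun z : ℂ => z • v) (𝓝 0) (𝓝 0) := by
      have := hline.continuousAt.tendsto
      rwa [hline0] at this
    filter_upwards [hlt.eventually (R.open_target.mem_nhds h0R), hδt.eventually hff,
      (hft.comp hδt).eventually (R.open_source.mem_nhds heR)] with z h1 h2 h3
    refine R.injOn h3 (R.map_target h1) ?_
    have h4 : F (R.symm (z • v)) = z • v := R.right_inv h1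
    have h5 : F (f (R.symm (z • v))) = D (F (R.symm (z • v))) := by
      simp only [hF, h2, map_smul, map_add, hDD', add_comm]
    change F (f (R.symm (z • v))) = F (R.symm (z • v))
    rw [h5, h4, map_smul, hv]

end LocalInvolution

section FixedVectors

variable {E : Type*} [NormedAddCommGroup E] [NormedSpace ℂ E] [CompleteSpace E]
  {G : Type*} [TopologicalSpace G] [ChartedSpace E G] [Group G] [LieGroup 𝓘(ℂ, E) ω G]

/-- A vector fixed by the derivative of an involution is the velocity of a curve of fixed points. -/
lemma exists_curve_of_derivOne_eq {f : G → G} (hf : ContMDiff 𝓘(ℂ, E) 𝓘(ℂ, E) ω f) (hf1 : f 1 = 1)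
    (hff : ∀ x, f (f x) = x) {v : E} (hv : derivOne (E := E) f v = v) :
    ∃ γ : ℂ → G, γ 0 = 1 ∧ (∀ᶠ z in 𝓝 (0 : ℂ), f (γ z) = γ z) ∧
      ContMDiffAt 𝓘(ℂ, ℂ) 𝓘(ℂ, E) ω γ 0 ∧ (velocity γ : E) = v := by
  have : IsManifold 𝓘(ℂ, E) ω G := ContMDiffMul.toIsManifold
  have : IsManifold 𝓘(ℂ, E) 1 G := IsManifold.of_le (n := ω) le_top
  have hψ1 := chartOne_symm_coordOne (E := E) (G := G)
  have hmem1 : (1 : G) ∈ (chartOne E G).source := mem_extChartAt_source 1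
  set ψ := (chartOne E G).symm with hψ
  set f' : E → E := fun y => chartOne E G (f (ψ y)) with hf'
  have hψc : ContMDiffAt 𝓘(ℂ, E) 𝓘(ℂ, E) ω ψ (coordOne E G) := contMDiffAt_chartOne_symm
  have hfψ : ContMDiffAt 𝓘(ℂ, E) 𝓘(ℂ, E) ω (fun y => f (ψ y)) (coordOne E G) :=
    ContMDiffAt.comp (g := f) (coordOne E G) hf.contMDiffAt hψc
  have hfψ1 : f (ψ (coordOne E G)) = 1 := by rw [hψ1, hf1]
  have hfc : ContDiffAt ℂ ω f' (coordOne E G) := by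
    have h1 : ContMDiffAt 𝓘(ℂ, E) 𝓘(ℂ, E) ω (chartOne E G) (f (ψ (coordOne E G))) :=
      contMDiffAt_chartOne (by rw [hfψ1]; exact hmem1)
    exact (ContMDiffAt.comp (g := chartOne E G) (coordOne E G) h1 hfψ).contDiffAt
  have hfe : f' (coordOne E G) = coordOne E G := by
    simp only [hf', hfψ1]
  have hfd : HasFDerivAt f' (mfderiv 𝓘(ℂ, E) 𝓘(ℂ, E) f 1 : E →L[ℂ] E) (coordOne E G) := by
    have h1 := hasFDerivAt_chart (E := E) (h := f) (hf.contMDiffAt.mdifferentiableAt (by simp))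
      (by rw [hf1]; exact hmem1)
    have h2 : ∀ a : G, a = 1 → ∀ T : E →L[ℂ] E,
        (mfderiv 𝓘(ℂ, E) 𝓘(ℂ, E) (chartOne E G) a : E →L[ℂ] E).comp T = T := by
      rintro a rfl T
      exact (congrArg (fun S : E →L[ℂ] E => S.comp T)
        (mfderiv_extChartAt_self (I := 𝓘(ℂ, E)) (x := (1 : G)))).trans (T.id_comp)
    exact h1.congr_fderiv (h2 _ hf1 _)
  have hsrc : ∀ᶠ y in 𝓝 (coordOne E G), f (ψ y) ∈ (chartOne E G).source := by
    have h1 := hfψ.continuousAt.tendsto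
    rw [hfψ1] at h1
    exact h1.eventually ((isOpen_extChartAt_source (1 : G)).mem_nhds hmem1)
  have hff' : ∀ᶠ y in 𝓝 (coordOne E G), f' (f' y) = y := by
    filter_upwards [hsrc, eventually_chartOne_right_inv (E := E) (G := G)] with y h1 h2
    simp only [hf']
    rw [(chartOne E G).left_inv h1, hff, h2]
  obtain ⟨δ, hδ0, hδc, hδd, hδf⟩ := exists_curve_of_involution hfc hfe hfd hff' hv
  have hδt : Filter.Tendsto δ (𝓝 0) (𝓝 (coordOne E G)) := hδ0 ▸ hδc.continuousAt.tendsto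
  have hψδ : ContMDiffAt 𝓘(ℂ, E) 𝓘(ℂ, E) ω ψ (δ 0) := by rwa [hδ0]
  refine ⟨fun z => ψ (δ z), by simp only [hδ0, hψ1], ?_,
    ContMDiffAt.comp (g := ψ) (0 : ℂ) hψδ hδc.contMDiffAt, ?_⟩
  · filter_upwards [hδf, hδt.eventually hsrc] with z h1 h2
    rw [← (chartOne E G).left_inv h2]
    exact congrArg ψ h1
  · have h1 : HasMFDerivAt 𝓘(ℂ, E) 𝓘(ℂ, E) ψ (δ 0) (ContinuousLinearMap.id ℂ E) := by
      rw [hδ0]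
      exact hasMFDerivAt_chartOne_symm
    have h2 := (h1.comp (0 : ℂ) hδd.hasFDerivAt.hasMFDerivAt).mfderiv
    refine (congrArg (fun T : ℂ →L[ℂ] E => T 1) h2).trans ?_
    change ((ContinuousLinearMap.id ℂ E).comp (ContinuousLinearMap.toSpanSingleton ℂ v)) 1 = v
    simp

/-- The Lie algebra of an open subgroup of the fixed point group of an involution contains all
fixed vectors of the derivative. -/
lemma mem_subgroupAlg_of_derivOne_eq {f : G → G} (hf : ContMDiff 𝓘(ℂ, E) 𝓘(ℂ, E) ω f)
    (hf1 : f 1 = 1) (hff : ∀ x, f (f x) = x) {K : Subgroup G} {V : Set G} (hV : IsOpen V)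
    (hK : (K : Set G) = {g | f g = g} ∩ V) {v : LieAlg E G} (hv : derivOne f v = v) :
    v ∈ subgroupAlg K := by
  obtain ⟨γ, h0, h1, h2, h3⟩ := exists_curve_of_derivOne_eq hf hf1 hff (v := v) hv
  refine ⟨γ, h0, ?_, h2, h3⟩
  have h1V : γ 0 ∈ V := by
    rw [h0]
    have h4 : (1 : G) ∈ (K : Set G) := K.one_mem
    rw [hK] at h4
    exact h4.2
  filter_upwards [h1, h2.continuousAt.eventually (hV.mem_nhds h1V)] with z h5 h6
  have h7 : γ z ∈ (K : Set G) := by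
    rw [hK]
    exact ⟨h5, h6⟩
  exact h7

end FixedVectors

/-! ### Coisotropy and density on the set of extremal elements. -/

section Coisotropy

variable {L : Type*} [LieRing L] [LieAlgebra ℂ L] {b : L →ₗ[ℂ] L →ₗ[ℂ] ℂ}

lemma continuous_bilinear [TopologicalSpace L] [IsTopologicalAddGroup L] [ContinuousSMul ℂ L]
    [T2Space L] [FiniteDimensional ℂ L] (β : L →ₗ[ℂ] L →ₗ[ℂ] ℂ) :
    Continuous fun p : L × L => β p.1 p.2 := by
  let e := Module.finBasis ℂ L
  have h1 : (fun p : L × L => β p.1 p.2) = fun p => ∑ i, e.coord i p.1 * β (e i) p.2 := by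
    ext p
    conv_lhs => rw [← e.sum_repr p.1]
    simp only [map_sum, map_smul, LinearMap.sum_apply, LinearMap.smul_apply, smul_eq_mul,
      Module.Basis.coord_apply]
  rw [h1]
  refine continuous_finsetSum _ fun i _ => ?_
  exact ((e.coord i).continuous_of_finiteDimensional.comp continuous_fst).mul
    ((β (e i)).continuous_of_finiteDimensional.comp continuous_snd)

namespace IsExtremal

lemma map (θ : L ≃ₗ⁅ℂ⁆ L) (hθ : ∀ x y, b (θ x) (θ y) = b x y) {x : L} (hx : IsExtremal b x) :
    IsExtremal b (θ x) := by
  intro z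
  obtain ⟨z, rfl⟩ : ∃ z', θ z' = z := θ.surjective z
  rw [← LieEquiv.map_lie, ← LieEquiv.map_lie, hx, hθ, map_smul]

/-- The tangent space of the diagonal orbit is coisotropic at a pair of extremal elements that are
not orthogonal. -/
lemma exists_lie_eq_lie (hb : IsInvariantForm b) {x y v w : L} (hx : IsExtremal b x)
    (hy : IsExtremal b y) (hxy : b x y ≠ 0) (h : ⁅x, v⁆ + ⁅y, w⁆ = 0) :
    ∃ z, ⁅x, v⁆ = ⁅x, z⁆ ∧ ⁅y, w⁆ = ⁅y, z⁆ := by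
  have h1 : ⁅x, v⁆ = ⁅y, -w⁆ := by rw [lie_neg, eq_neg_iff_add_eq_zero, h]
  obtain ⟨c, hc⟩ := hx.mem_span_lie hb hy hxy h1
  -- Bracketing `x + y` with `x` and with `y` gives `[x, y]` and `-[x, y]`, exactly the opposite
  -- pair required.
  refine ⟨c • (x + y), by rw [hc, lie_smul, lie_add, lie_self, zero_add], ?_⟩
  rw [lie_smul, lie_add, lie_self, add_zero, ← lie_skew y x, smul_neg, ← hc, h1, lie_neg, neg_neg]

lemma exists_fixed_lie_eq (hb : IsInvariantForm b) {θ : L ≃ₗ⁅ℂ⁆ L}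
    (hθ : ∀ x y, b (θ x) (θ y) = b x y) (hθθ : ∀ x, θ (θ x) = x) {x v : L}
    (hx : IsExtremal b x) (hxθ : b x (θ x) ≠ 0)
    (hv : θ ⁅x, v⁆ = -⁅x, v⁆) : ∃ z, θ z = z ∧ ⁅x, v⁆ = ⁅x, z⁆ := by
  have h1 : ⁅x, v⁆ = ⁅θ x, -θ v⁆ := by rw [lie_neg, ← LieEquiv.map_lie, hv, neg_neg]
  obtain ⟨c, hc⟩ := hx.mem_span_lie hb (hx.map θ hθ) hxθ h1
  refine ⟨c • (x + θ x), by rw [map_smul, map_add, hθθ, add_comm], ?_⟩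
  rw [hc, lie_smul, lie_add, lie_self, zero_add]

end IsExtremal

/-- The set of nonzero extremal elements. -/
def extremalSet (b : L →ₗ[ℂ] L →ₗ[ℂ] ℂ) : Set L := {x | IsExtremal b x ∧ x ≠ 0}

namespace IsAdExp

variable [TopologicalSpace L] {A : L → L → L} (hA : IsAdExp A)
include hA

lemma apply_zero (w : L) : A w 0 = 0 := by
  simpa using hA.apply_smul w 0 0

lemma apply_mem_extremalSet (hb : IsInvariantForm b) (w : L) :
    ∀ x ∈ extremalSet b, A w x ∈ extremalSet b := by
  rintro x ⟨hx, hx0⟩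
  refine ⟨hA.isExtremal_apply hb hx w, fun h => hx0 ?_⟩
  rw [← hA.neg_apply w x, h, hA.apply_zero]

/-- If the involution `θ` reverses no nonzero extremal element, then it commutes with each of them
and is orthogonal to it. -/
lemma form_lie_involution_eq_zero (hb : IsInvariantForm b) {θ : L ≃ₗ⁅ℂ⁆ L}
    (hθ : ∀ x y, b (θ x) (θ y) = b x y) (hθθ : ∀ x, θ (θ x) = x)
    (hno : ∀ x ∈ extremalSet b, θ x ≠ -x) {x : L} (hx : x ∈ extremalSet b) :
    b x (θ x) = 0 ∧ ⁅x, θ x⁆ = 0 := by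
  have hy : IsExtremal b (θ x) := hx.1.map θ hθ
  have hform : b x (θ x) = 0 := by
    by_contra h
    -- With `t² b(x, θx) = -1`, `exp (t ad θx) x = x - t[x, θx] - θx`, an extremal element reversed
    -- by `θ`.
    obtain ⟨t, ht⟩ := IsAlgClosed.exists_pow_nat_eq (-(b x (θ x))⁻¹) (n := 2) two_pos
    have ht2 : t * t * b x (θ x) = -1 := by
      rw [← sq, ht, neg_mul, inv_mul_cancel₀ h]
    have h1 := hA.apply_mem_extremalSet hb (t • θ x) x hx
    have h2 : A (t • θ x) x = x - t • ⁅x, θ x⁆ - θ x := by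
      rw [hA.of_lie_lie_lie_eq_zero]
      · simp only [smul_lie, lie_smul, hy x, hb.symm (θ x) x, smul_smul]
        rw [← lie_skew, show (2⁻¹ : ℂ) * (t * (t * (2 * b x (θ x)))) = -1 by
          linear_combination ht2]
        module
      · simp [hy x]
    rw [h2] at h1
    refine hno _ h1 ?_
    rw [map_sub, map_sub, map_smul, LieEquiv.map_lie, hθθ, ← lie_skew (θ x) x]
    module
  refine ⟨hform, ?_⟩
  -- Otherwise `[x, θx]` is itself extremal and reversed by `θ`.
  by_contra h
  refine hno _ ⟨hx.1.lie_of_orthogonal hb hy hform, h⟩ ?_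
  rw [LieEquiv.map_lie, hθθ, lie_skew]

variable [LieAlgebra.IsSimple ℂ L] (hb : IsInvariantForm b)
  (hnd : ∀ u, (∀ z, b u z = 0) → u = 0)
include hb hnd

lemma dense_form_ne_zero : extremalSet b ×ˢ extremalSet b ⊆
    closure ((extremalSet b ×ˢ extremalSet b) ∩ {p | b p.1 p.2 ≠ 0}) := by
  rintro ⟨x, y⟩ ⟨hx, hy⟩
  rw [mem_closure_iff_nhds]
  intro N hN
  obtain ⟨N₁, hN₁, N₂, hN₂, hN⟩ := mem_nhds_prod_iff.mp hN
  obtain ⟨N₂', hN₂', hopen, hyN⟩ := mem_nhds_iff.mp hN₂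
  obtain ⟨y', hy', hy'N, hxy'⟩ := hA.exists_form_ne_zero (hA.apply_mem_extremalSet hb) hnd hopen
    hy.2 hy hyN hx.2
  exact ⟨(x, y'), hN ⟨mem_of_mem_nhds hN₁, hN₂' hy'N⟩, ⟨hx, hy'⟩, hxy'⟩

variable {θ : L ≃ₗ⁅ℂ⁆ L} (hθ : ∀ x y, b (θ x) (θ y) = b x y)
include hθ

/-- A fixed `x` satisfies `b(θz - z, x) = 0`, and a nonzero linear form cannot vanish on an open
piece of the extremal set. -/
lemma dense_involution_ne {z : L} (hz : θ z ≠ z) :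
    extremalSet b ⊆ closure (extremalSet b ∩ {x | θ x ≠ x}) := by
  intro x hx
  rw [mem_closure_iff]
  intro N hN hxN
  obtain ⟨y, hy, hyN, hzy⟩ := hA.exists_form_ne_zero (hA.apply_mem_extremalSet hb) hnd hN hx.2 hx
    hxN (sub_ne_zero.mpr hz)
  refine ⟨y, hyN, hy, fun hyθ => hzy ?_⟩
  rw [map_sub, LinearMap.sub_apply, ← hθ z, hyθ, sub_self]

variable (hθθ : ∀ x, θ (θ x) = x)
include hθθ

/-- If density failed, the quadratic form `b(x, θx)` would vanish on all nonzero extremal elements.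
Its second derivative at `m` in the direction `z` is `-8 b(m, z)²`, which would force `m = 0`. -/
lemma dense_form_involution_ne_zero {m : L} (hm : m ∈ extremalSet b) (hmθ : θ m = -m) :
    extremalSet b ⊆ closure (extremalSet b ∩ {x | b x (θ x) ≠ 0}) := by
  have hS := hA.apply_mem_extremalSet hb
  intro x hx
  by_contra hx'
  let β : L →ₗ[ℂ] L →ₗ[ℂ] ℂ := b.compl₂ (θ : L →ₗ[ℂ] L)
  have hβ : ∀ x ∈ extremalSet b, β x x = 0 := fun y hy =>
    hA.vanishing_of_vanishing_open hS hb hnd (N := (closure _)ᶜ) isClosed_closure.isOpen_compl hx.2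
      hx.1 hx hx' (fun z hz hzN => by
        by_contra hz'
        exact hzN (subset_closure ⟨hz, hz'⟩)) hy.1 hy.2
  refine hm.2 (hnd m fun z => ?_)
  have h1 := hA.vanishing_deriv hS (hA.vanishing_deriv hS hβ z) z m hm
  have hadj : ∀ x y, b x (θ y) = b (θ x) y := fun x y => by rw [← hθ, hθθ]
  have h2 : ∀ w, b ⁅z, m⁆ ⁅w, m⁆ = -(2 * b m w * b m z) := by
    intro w
    rw [← lie_skew z m, ← lie_skew w m, map_neg, map_neg, LinearMap.neg_apply, neg_neg,
      hb.lie_left, hm.1, map_smul, hb.symm z m, smul_eq_mul]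
  have h3 : b ⁅z, ⁅z, m⁆⁆ m = 2 * b m z * b m z := by
    rw [hb.lie_left, h2, neg_neg]
  have h4 : b m (θ z) = -b m z := by rw [hadj, hmθ, map_neg, LinearMap.neg_apply]
  have h5 : b ⁅z, m⁆ (θ ⁅z, m⁆) = -(2 * b m z * b m z) := by
    rw [LieEquiv.map_lie, hmθ, lie_neg, map_neg, h2, h4]
    ring
  have h6 : b ⁅z, ⁅z, m⁆⁆ (θ m) = -(2 * b m z * b m z) := by rw [hmθ, map_neg, h3]
  have h7 : b m (θ ⁅z, ⁅z, m⁆⁆) = -(2 * b m z * b m z) := by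
    rw [hadj, hmθ, map_neg, LinearMap.neg_apply, hb.symm, h3]
  have h8 : b ⁅z, ⁅z, m⁆⁆ (θ m) + b ⁅z, m⁆ (θ ⁅z, m⁆) + (b ⁅z, m⁆ (θ ⁅z, m⁆) +
      b m (θ ⁅z, ⁅z, m⁆⁆)) = 0 := h1
  rw [h5, h6, h7] at h8
  have h9 : b m z * b m z = 0 := by linear_combination (-1 / 8 : ℂ) * h8
  exact mul_self_eq_zero.mp h9

-- Differentiating `[x, θx] = 0` in the direction of `[x, v]` gives `b(x, v) (θx - x) = 0`, so `b(x,
-- v) = 0`. Then `exists_in_span_sub` applies to `x`, `θx` and `[x, v]`, and `θ` negates the whole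
-- span of `x - θx` and `[x, v]`.
omit [LieAlgebra.IsSimple ℂ L] in
lemma lie_eq_zero_of_involution [FiniteDimensional ℂ L] (hno : ∀ x ∈ extremalSet b, θ x ≠ -x)
    {x v : L} (hx : x ∈ extremalSet b) (hxθ : θ x ≠ x) (hv : θ ⁅x, v⁆ = -⁅x, v⁆) :
    ⁅x, v⁆ = 0 := by
  have hy : IsExtremal b (θ x) := hx.1.map θ hθ
  have hu : ⁅x, v⁆ = ⁅θ x, -θ v⁆ := by rw [lie_neg, ← LieEquiv.map_lie, hv, neg_neg]
  have h1 : ⁅⁅x, v⁆, θ x⁆ = ⁅x, ⁅x, v⁆⁆ := by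
    rw [← sub_eq_zero]
    refine hnd _ fun z => ?_
    let β : L →ₗ[ℂ] L →ₗ[ℂ] ℂ :=
      ((LieAlgebra.ad ℂ L : L →ₗ[ℂ] Module.End ℂ L).compr₂ (b z)).compl₂ (θ : L →ₗ[ℂ] L)
    have hβ : ∀ x ∈ extremalSet b, β x x = 0 := by
      intro x hx
      change b z ⁅x, θ x⁆ = 0
      rw [(hA.form_lie_involution_eq_zero hb hθ hθθ hno hx).2, map_zero]
    have h2 := hA.vanishing_deriv (hA.apply_mem_extremalSet hb) hβ (-v) x hx
    have h3 : b z ⁅⁅-v, x⁆, θ x⁆ + b z ⁅x, θ ⁅-v, x⁆⁆ = 0 := h2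
    rw [neg_lie, lie_skew, hv, lie_neg, ← map_add, ← sub_eq_add_neg] at h3
    rw [hb.symm, h3]
  have hxv : b x v = 0 := by
    rw [hx.1, ← lie_skew, hu, hy, map_neg, hθ, ← sub_eq_zero] at h1
    have h2 : (2 * b x v) • (θ x - x) = 0 := by
      rw [← h1]
      module
    simpa [sub_ne_zero.mpr hxθ] using h2
  by_contra h
  obtain ⟨s, t, hne, hext⟩ := hx.1.exists_in_span_sub hb hnd hy hxθ.symm
    (hA.form_lie_involution_eq_zero hb hθ hθθ hno hx).2 h rfl hu hxv
    (by rw [map_neg, hθ, hxv, neg_zero])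
  refine hno _ ⟨hext, hne⟩ ?_
  rw [map_add, map_smul, map_smul, map_sub, hθθ, hv]
  module

/-- The fixed algebra of an involution has coisotropic orbits through a dense open set of extremal
elements. -/
theorem exists_dense_coisotropic [FiniteDimensional ℂ L] [IsTopologicalAddGroup L]
    [ContinuousSMul ℂ L] [T2Space L] : ∃ N : Set L, IsOpen N ∧
      extremalSet b ⊆ closure (extremalSet b ∩ N) ∧
      (∀ τ : L ≃ₗ⁅ℂ⁆ L, (∀ x y, b (τ x) (τ y) = b x y) → (∀ x, τ (θ x) = θ (τ x)) →
        ∀ x ∈ N, τ x ∈ N) ∧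
      ∀ x ∈ extremalSet b, x ∈ N → ∀ v, θ ⁅x, v⁆ = -⁅x, v⁆ → ∃ z, θ z = z ∧ ⁅x, v⁆ = ⁅x, z⁆ := by
  have hcont : Continuous θ := (θ : L →ₗ[ℂ] L).continuous_of_finiteDimensional
  -- With no reversed extremal element the orthogonal is zero off the fixed locus, or `θ` is the
  -- identity. With one, the locus `b(x, θx) ≠ 0` serves.
  by_cases hno : ∀ x ∈ extremalSet b, θ x ≠ -x
  · by_cases hid : ∀ z, θ z = z
    · refine ⟨Set.univ, isOpen_univ, by simpa using subset_closure, fun _ _ _ _ _ => trivial,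
        fun x _ _ v _ => ⟨v, hid v, rfl⟩⟩
    · obtain ⟨z, hz⟩ := not_forall.mp hid
      refine ⟨{x | θ x ≠ x}, (isClosed_eq hcont continuous_id).isOpen_compl,
        hA.dense_involution_ne hb hnd hθ hz, fun τ _ hτ x hx h => hx ?_,
        fun x hx hxN v hv => ⟨0, map_zero θ, ?_⟩⟩
      · exact τ.injective ((hτ x).trans h)
      · rw [lie_zero, hA.lie_eq_zero_of_involution hb hnd hθ hθθ hno hx hxN hv]
  · push Not at hno
    obtain ⟨m, hm, hmθ⟩ := hno
    refine ⟨{x | b x (θ x) ≠ 0}, ?_, hA.dense_form_involution_ne_zero hb hnd hθ hθθ hm hmθ,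
      fun τ hτ hτθ x hx => ?_, fun x hx hxN v hv => hx.1.exists_fixed_lie_eq hb hθ hθθ hxN hv⟩
    · exact isOpen_ne.preimage ((continuous_bilinear b).comp (continuous_id.prodMk hcont))
    · rw [Set.mem_ofPred_eq, ← hτθ, hτ]
      exact hx

end IsAdExp

end Coisotropy

/-- Commuting with the nilpotent `ad x` makes `ad x ad z` nilpotent, hence traceless. By duality
this places a nilpotent `x` in the image of `ad x`, a weak form of Jacobson–Morozov. -/
lemma killingForm_eq_zero_of_lie_eq_zero {L : Type*} [LieRing L] [LieAlgebra ℂ L] {x z : L}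
    (hx : IsNilpotent (LieAlgebra.ad ℂ L x)) (h : ⁅x, z⁆ = 0) : killingForm ℂ L x z = 0 := by
  have hcomm : Commute (LieAlgebra.ad ℂ L x) (LieAlgebra.ad ℂ L z) := by
    ext w
    change ⁅x, ⁅z, w⁆⁆ = ⁅z, ⁅x, w⁆⁆
    rw [leibniz_lie, h, zero_lie, zero_add]
  exact (LinearMap.isNilpotent_trace_of_isNilpotent (hcomm.isNilpotent_mul_right hx)).eq_zero

/-! ### The minimal orbit as the set of extremal elements. -/

section MinimalOrbit

variable {E : Type*} [NormedAddCommGroup E] [NormedSpace ℂ E]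
  {G : Type*} [TopologicalSpace G] [ChartedSpace E G] [Group G]

instance [FiniteDimensional ℂ E] : FiniteDimensional ℂ (LieAlg E G) :=
  inferInstanceAs (FiniteDimensional ℂ E)

instance : T2Space (LieAlg E G) := inferInstanceAs (T2Space E)

instance [FiniteDimensional ℂ E] : FiniteDimensional ℂ (LieDual E G) :=
  inferInstanceAs (FiniteDimensional ℂ (E →L[ℂ] ℂ))

variable {b : LieAlg E G →ₗ[ℂ] LieAlg E G →ₗ[ℂ] ℂ}

lemma exists_dual_equiv [FiniteDimensional ℂ E] (hnd : ∀ u, (∀ z, b u z = 0) → u = 0) :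
    ∃ ψ : LieAlg E G ≃L[ℂ] LieDual E G, ∀ x z, ψ x z = b x z := by
  have hinj : Function.Injective b := (injective_iff_map_eq_zero b).mpr fun u hu =>
    hnd u fun z => by rw [hu, LinearMap.zero_apply]
  let e : LieAlg E G ≃ₗ[ℂ] Module.Dual ℂ (LieAlg E G) :=
    b.linearEquivOfInjective hinj Subspace.dual_finrank_eq.symm
  exact ⟨(e.trans LinearMap.toContinuousLinearMap).toContinuousLinearEquiv, fun x z => rfl⟩

variable [LieGroup 𝓘(ℂ, E) ω G] [CompleteSpace E]

/-- The adjoint action of an element of the group as an automorphism of the Lie algebra. -/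
def adEquiv (g : G) : LieAlg E G ≃ₗ⁅ℂ⁆ LieAlg E G :=
  { (Ad E g : LieAlg E G →ₗ[ℂ] LieAlg E G) with
    map_lie' := Ad_lie g _ _
    invFun := Ad E g⁻¹
    left_inv := Ad_inv_apply g
    right_inv := fun x => by simpa using Ad_inv_apply g⁻¹ x }

lemma adEquiv_apply (g : G) (x : LieAlg E G) : adEquiv g x = Ad E g x := rfl

lemma coAd_dual (hτ : ∀ (τ : LieAlg E G ≃ₗ⁅ℂ⁆ LieAlg E G) x y, b (τ x) (τ y) = b x y)
    {ψ : LieAlg E G ≃L[ℂ] LieDual E G} (hψ : ∀ x z, ψ x z = b x z) (g : G) (x : LieAlg E G) :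
    coAd g (ψ x) = ψ (Ad E g x) := by
  ext z
  have h1 : Ad E g (Ad E g⁻¹ z) = z := by simpa using Ad_inv_apply g⁻¹ z
  have h2 : coAd g (ψ x) z = ψ x (Ad E g⁻¹ z) := rfl
  rw [h2, hψ, hψ, ← hτ (adEquiv g), adEquiv_apply, adEquiv_apply, h1]

lemma coadjointOrbit_dual
    (hτ : ∀ (τ : LieAlg E G ≃ₗ⁅ℂ⁆ LieAlg E G) x y, b (τ x) (τ y) = b x y)
    {ψ : LieAlg E G ≃L[ℂ] LieDual E G} (hψ : ∀ x z, ψ x z = b x z) (x : LieAlg E G) :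
    coadjointOrbit (ψ x) = ψ '' Set.range fun g : G => Ad E g x := by
  rw [coadjointOrbit, ← Set.range_comp]
  congr 1
  ext1 g
  exact coAd_dual hτ hψ g x

lemma Ad_mem_extremalSet (hτ : ∀ (τ : LieAlg E G ≃ₗ⁅ℂ⁆ LieAlg E G) x y, b (τ x) (τ y) = b x y)
    (g : G) {x : LieAlg E G} (hx : x ∈ extremalSet b) : Ad E g x ∈ extremalSet b :=
  ⟨hx.1.map (adEquiv g) (hτ _), fun h => hx.2 ((adEquiv g).injective (h.trans (map_zero _).symm))⟩

lemma expAd_mem_range_Ad (x w : LieAlg E G) :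
    ∀ y ∈ Set.range fun g : G => Ad E g x, expAd w y ∈ Set.range fun g : G => Ad E g x := by
  rintro _ ⟨g, rfl⟩
  obtain ⟨h, hh⟩ := exists_Ad_eq_expAd w
  refine ⟨h * g, ?_⟩
  simp only [Ad_mul, ← hh]
  rfl

variable [FiniteDimensional ℂ E] [LieAlgebra.IsSimple ℂ (LieAlg E G)]

/-- The minimal nilpotent orbit consists of the functionals that are represented by the nonzero
extremal elements. -/
theorem IsMinimalNilpotentOrbit.exists_eq_image {O : Set (LieDual E G)}
    (hO : IsMinimalNilpotentOrbit O) :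
    ∃ (b : LieAlg E G →ₗ[ℂ] LieAlg E G →ₗ[ℂ] ℂ) (ψ : LieAlg E G ≃L[ℂ] LieDual E G),
      IsInvariantForm b ∧ (∀ u, (∀ z, b u z = 0) → u = 0) ∧
      (∀ (τ : LieAlg E G ≃ₗ⁅ℂ⁆ LieAlg E G) x y, b (τ x) (τ y) = b x y) ∧
      (∀ x z, ψ x z = b x z) ∧ O = ψ '' extremalSet b := by
  obtain ⟨κ, hκ, m, hm0, hm⟩ := exists_isExtremal_smul_killingForm (LieAlg E G)
    (LieAlgebra.IsSimple.non_abelian ℂ)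
  set b := κ • killingForm ℂ (LieAlg E G)
  have hbk : ∀ x z, b x z = κ * killingForm ℂ (LieAlg E G) x z := fun x z => rfl
  have hb : IsInvariantForm b := isInvariantForm_smul_killingForm (LieAlg E G) κ
  have hnd : ∀ u, (∀ z, b u z = 0) → u = 0 := fun u hu =>
    (LieAlgebra.IsKilling.killingForm_nondegenerate ℂ (LieAlg E G)).1 u fun z => by
      simpa [hbk, hκ] using hu z
  have hτ : ∀ (τ : LieAlg E G ≃ₗ⁅ℂ⁆ LieAlg E G) x y, b (τ x) (τ y) = b x y := fun τ x y => by
    rw [hbk, hbk, LieAlgebra.killingForm_of_equiv_apply]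
  clear_value b
  obtain ⟨ψ, hψ⟩ := exists_dual_equiv hnd
  refine ⟨b, ψ, hb, hnd, hτ, hψ, ?_⟩
  have hA := isAdExp_expAd (E := E) (G := G)
  obtain ⟨⟨l, hl0, ⟨x', hx'nil, hx'⟩, rfl⟩, hmin⟩ := hO
  obtain ⟨x, rfl⟩ := ψ.surjective l
  have hx0 : x ≠ 0 := fun h => hl0 (by rw [h, map_zero])
  have hxx' : x' = κ • x := by
    rw [← sub_eq_zero]
    refine hnd _ fun z => ?_
    rw [map_sub, map_smul, LinearMap.sub_apply, LinearMap.smul_apply, hbk x', ← hx' z, hψ,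
      smul_eq_mul, sub_self]
  -- The semisimple-like `h` supplies the rescaling needed for the closure argument.
  have hxm : ∃ h : LieAlg E G, ⁅h, x⁆ = x := by
    obtain ⟨u, hu⟩ := hb.exists_lie_eq hnd (x := x) (y := x) fun z hz => by
      have h1 : ⁅x', z⁆ = 0 := by rw [hxx', smul_lie, hz, smul_zero]
      have h2 := killingForm_eq_zero_of_lie_eq_zero hx'nil h1
      rwa [← hx', hψ] at h2
    exact ⟨-u, by rw [neg_lie, lie_skew, hu]⟩
  obtain ⟨h, hh⟩ := hxm
  have hself : ∀ y : LieAlg E G, y ∈ Set.range fun g : G => Ad E g y := fun y =>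
    ⟨1, congrArg (fun T : LieAlg E G →L[ℂ] LieAlg E G => T y) Ad_one⟩
  have hrange : ψ '' (Set.range fun g : G => Ad E g m) = ψ '' extremalSet b := by
    congr 1
    refine Set.Subset.antisymm ?_ fun y hy =>
      hA.mem_of_isExtremal (expAd_mem_range_Ad m) hb hnd hm hm0 (hself m) hy.1 hy.2
    rintro _ ⟨g, rfl⟩
    exact Ad_mem_extremalSet hτ g ⟨hm, hm0⟩
  -- Minimality is applied to the orbit of `ψ m`. Its representative `κ • m` is nilpotent of
  -- exponent `3`, since `(ad m)²` has image in the line of `m`.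
  rw [← hrange, ← coadjointOrbit_dual hτ hψ]
  refine (hmin _ ⟨ψ m, fun h => hm0 (ψ.injective (h.trans (map_zero ψ).symm)),
    ⟨κ • m, ⟨3, ?_⟩, fun z => ?_⟩, rfl⟩ ?_).symm
  · ext z
    have h1 := (hm.smul κ) z
    have h2 : (LieAlgebra.ad ℂ (LieAlg E G) (κ • m) ^ 3) z = ⁅κ • m, ⁅κ • m, ⁅κ • m, z⁆⁆⁆ := rfl
    rw [h2, h1, lie_smul, lie_self, smul_zero, LinearMap.zero_apply]
  · rw [hψ, hbk, map_smul, LinearMap.smul_apply, smul_eq_mul]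
  · rw [coadjointOrbit_dual hτ hψ, coadjointOrbit_dual hτ hψ, hrange]
    refine Set.Subset.trans (Set.image_mono fun y hy => ?_) (image_closure_subset_closure_image
      ψ.continuous)
    exact hA.mem_closure_of_isExtremal (expAd_mem_range_Ad x) hnd hx0 hh (hself x) hy.1 hy.2

end MinimalOrbit

/-! ### Transfer to the coadjoint actions. -/

section Actions

variable {E : Type*} [NormedAddCommGroup E] [NormedSpace ℂ E]
  {G : Type*} [TopologicalSpace G] [ChartedSpace E G] [Group G]

lemma derivOne_derivOne {θ : G ≃* G} (hθ : ContMDiff 𝓘(ℂ, E) 𝓘(ℂ, E) ω θ)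
    (hθθ : ∀ g, θ (θ g) = g) (x : LieAlg E G) : derivOne θ (derivOne θ x) = x := by
  have hd : MDifferentiableAt 𝓘(ℂ, E) 𝓘(ℂ, E) θ 1 := hθ.contMDiffAt.mdifferentiableAt (by simp)
  have h1 := derivOne_comp (E := E) hd hd (map_one θ)
  rw [show θ ∘ θ = id from funext hθθ, derivOne_id] at h1
  exact (congrArg (fun T : LieAlg E G →L[ℂ] LieAlg E G => T x) h1).symm

variable [LieGroup 𝓘(ℂ, E) ω G] [CompleteSpace E]

/-- The derivative of a holomorphic involution of the group, as an automorphism of the Lie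
algebra. -/
def involutionEquiv (θ : G ≃* G) (hθ : ContMDiff 𝓘(ℂ, E) 𝓘(ℂ, E) ω θ) (hθθ : ∀ g, θ (θ g) = g) :
    LieAlg E G ≃ₗ⁅ℂ⁆ LieAlg E G :=
  { (derivOne (E := E) θ : LieAlg E G →L[ℂ] LieAlg E G).toLinearMap with
    map_lie' := derivOne_lie hθ hθ hθθ hθθ (map_mul θ) _ _
    invFun := derivOne (E := E) θ
    left_inv := derivOne_derivOne hθ hθθ
    right_inv := derivOne_derivOne hθ hθθ }

lemma involutionEquiv_involutionEquiv {θ : G ≃* G} (hθ : ContMDiff 𝓘(ℂ, E) 𝓘(ℂ, E) ω θ)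
    (hθθ : ∀ g, θ (θ g) = g) (x : LieAlg E G) :
    involutionEquiv θ hθ hθθ (involutionEquiv θ hθ hθθ x) = x :=
  (involutionEquiv θ hθ hθθ).symm_apply_apply x

lemma involutionEquiv_adEquiv {θ : G ≃* G} (hθ : ContMDiff 𝓘(ℂ, E) 𝓘(ℂ, E) ω θ)
    (hθθ : ∀ g, θ (θ g) = g) {k : G} (hk : θ k = k) (x : LieAlg E G) :
    adEquiv k (involutionEquiv θ hθ hθθ x) = involutionEquiv θ hθ hθθ (adEquiv k x) := by
  have hd : MDifferentiableAt 𝓘(ℂ, E) 𝓘(ℂ, E) θ 1 := hθ.contMDiffAt.mdifferentiableAt (by simp)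
  have hd' : MDifferentiableAt 𝓘(ℂ, E) 𝓘(ℂ, E) (fun x : G => k * x * k⁻¹) 1 :=
    (contMDiff_conj k).contMDiffAt.mdifferentiableAt (by simp)
  have h1 := derivOne_comp (E := E) hd hd' (map_one θ)
  have h2 := derivOne_comp (E := E) hd' hd (by simp)
  have h3 : (fun x : G => k * x * k⁻¹) ∘ θ = θ ∘ fun x : G => k * x * k⁻¹ := by
    ext g
    simp [hk]
  rw [h3, h2] at h1
  exact (congrArg (fun T : LieAlg E G →L[ℂ] LieAlg E G => T x) h1).symm

variable {b : LieAlg E G →ₗ[ℂ] LieAlg E G →ₗ[ℂ] ℂ} (hb : IsInvariantForm b)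
  {ψ : LieAlg E G ≃L[ℂ] LieDual E G} (hψ : ∀ x z, ψ x z = b x z)
include hb hψ

lemma dual_lie (x v w : LieAlg E G) : ψ x ⁅v, w⁆ = b ⁅x, v⁆ w := by
  rw [hψ, hb.inv]

/-- Tangent vectors at `ψ x` are determined by their brackets with `x`, so the algebra above can
ignore the quotient. -/
lemma mk_eq_mk_of_lie_eq {x v w : LieAlg E G} (h : ⁅x, v⁆ = ⁅x, w⁆) :
    (Submodule.Quotient.mk v : OrbitTangent (ψ x)) = Submodule.Quotient.mk w := by
  refine (Submodule.Quotient.eq _).mpr fun u => ?_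
  rw [← lie_skew, map_neg, dual_lie hb hψ, lie_sub, h, sub_self, map_zero, LinearMap.zero_apply,
    neg_zero]

variable [FiniteDimensional ℂ E] [LieAlgebra.IsSimple ℂ (LieAlg E G)]
  (hnd : ∀ u, (∀ z, b u z = 0) → u = 0)
  (hτ : ∀ (τ : LieAlg E G ≃ₗ⁅ℂ⁆ LieAlg E G) x y, b (τ x) (τ y) = b x y)
include hnd hτ

theorem isDiagonalCoisotropic_image :
    IsDiagonalCoisotropic (ψ '' extremalSet b) (ψ '' extremalSet b) := by
  have hA := isAdExp_expAd (E := E) (G := G)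
  have hcont : Continuous fun p : LieDual E G × LieDual E G => b (ψ.symm p.1) (ψ.symm p.2) :=
    (continuous_bilinear b).comp (ψ.symm.continuous.prodMap ψ.symm.continuous)
  refine ⟨_, ⟨{p | b (ψ.symm p.1) (ψ.symm p.2) ≠ 0}, isOpen_ne.preimage hcont, rfl⟩, ?_, ?_, ?_⟩
  · rintro ⟨_, _⟩ ⟨⟨x, hx, rfl⟩, y, hy, rfl⟩
    have h1 := hA.dense_form_ne_zero hb hnd (Set.mk_mem_prod hx hy)
    refine map_mem_closure (f := Prod.map ψ ψ) (ψ.continuous.prodMap ψ.continuous) h1 ?_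
    rintro ⟨x', y'⟩ ⟨⟨hx', hy'⟩, hxy⟩
    refine ⟨⟨⟨x', hx', rfl⟩, y', hy', rfl⟩, ?_⟩
    simpa using hxy
  · rintro g ⟨_, _⟩ ⟨⟨⟨x, hx, rfl⟩, y, hy, rfl⟩, hxy⟩
    simp only [Set.mem_ofPred_eq, ψ.symm_apply_apply] at hxy
    simp only [coAd_dual hτ hψ]
    refine ⟨⟨⟨_, Ad_mem_extremalSet hτ g hx, rfl⟩, _, Ad_mem_extremalSet hτ g hy, rfl⟩, ?_⟩
    simp only [Set.mem_ofPred_eq, ψ.symm_apply_apply]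
    rwa [← adEquiv_apply, ← adEquiv_apply, hτ]
  · rintro ⟨_, _⟩ ⟨⟨⟨x, hx, rfl⟩, y, hy, rfl⟩, hxy⟩ ⟨v, w⟩ hvw
    simp only [Set.mem_ofPred_eq, ψ.symm_apply_apply] at hxy
    obtain ⟨v, rfl⟩ := Submodule.Quotient.mk_surjective _ v
    obtain ⟨w, rfl⟩ := Submodule.Quotient.mk_surjective _ w
    -- Orthogonality to all diagonal vectors, read through nondegeneracy of `b`.
    have h1 : ⁅x, v⁆ + ⁅y, w⁆ = 0 := by
      refine hnd _ fun z => ?_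
      rw [map_add, LinearMap.add_apply, ← dual_lie hb hψ, ← dual_lie hb hψ]
      exact hvw _ ⟨z, rfl⟩
    obtain ⟨z, hz1, hz2⟩ := hx.1.exists_lie_eq_lie hb hy.1 hxy h1
    exact ⟨z, Prod.ext (mk_eq_mk_of_lie_eq hb hψ hz1).symm (mk_eq_mk_of_lie_eq hb hψ hz2).symm⟩

theorem isCoisotropicOnOrbit_image {K : Subgroup G} (hK : IsComplexSymmetricPair (E := E) K) :
    IsCoisotropicOnOrbit K (ψ '' extremalSet b) := by
  obtain ⟨θ, hθ, hθθ, V, hV, hKV⟩ := hK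
  have hA := isAdExp_expAd (E := E) (G := G)
  set σ := involutionEquiv θ hθ hθθ with hσ
  have hσσ : ∀ x, σ (σ x) = x := involutionEquiv_involutionEquiv hθ hθθ
  obtain ⟨N, hN, hdense, hstable, hcois⟩ := hA.exists_dense_coisotropic hb hnd (hτ σ) hσσ
  refine ⟨_, ⟨ψ.symm ⁻¹' N, hN.preimage ψ.symm.continuous, rfl⟩, ?_, ?_, ?_⟩
  · rintro _ ⟨x, hx, rfl⟩
    refine map_mem_closure ψ.continuous (hdense hx) ?_
    rintro y ⟨hy, hyN⟩
    exact ⟨⟨y, hy, rfl⟩, by simpa using hyN⟩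
  · rintro ⟨k, hk⟩ _ ⟨⟨x, hx, rfl⟩, hxN⟩
    rw [Set.mem_preimage, ψ.symm_apply_apply] at hxN
    have hkθ : θ k = k := by
      have h1 : k ∈ (K : Set G) := hk
      rw [hKV] at h1
      exact h1.1
    simp only [coAd_dual hτ hψ]
    refine ⟨⟨_, Ad_mem_extremalSet hτ k hx, rfl⟩, ?_⟩
    rw [Set.mem_preimage, ψ.symm_apply_apply]
    exact hstable (adEquiv k) (hτ _) (involutionEquiv_adEquiv hθ hθθ hkθ) x hxN
  · rintro _ ⟨⟨x, hx, rfl⟩, hxN⟩ v hv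
    rw [Set.mem_preimage, ψ.symm_apply_apply] at hxN
    obtain ⟨v, rfl⟩ := Submodule.Quotient.mk_surjective _ v
    have hfix : ∀ w, σ w = w → w ∈ subgroupAlg K := fun w hw =>
      mem_subgroupAlg_of_derivOne_eq hθ (map_one θ) hθθ hV hKV hw
    -- Testing against the fixed vectors `σ z + z`, for arbitrary `z`, turns orthogonality to the
    -- `K`-orbit into this sign condition.
    have h1 : σ ⁅x, v⁆ = -⁅x, v⁆ := by
      rw [eq_neg_iff_add_eq_zero]
      refine hnd _ fun z => ?_
      have h2 : b (σ ⁅x, v⁆) z = b ⁅x, v⁆ (σ z) := by rw [← hτ σ, hσσ]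
      rw [map_add, LinearMap.add_apply, h2, ← map_add, ← dual_lie hb hψ]
      exact hv _ ⟨σ z + z, hfix _ (by rw [map_add, hσσ, add_comm]), rfl⟩
    obtain ⟨z, hz, hvz⟩ := hcois x hx hxN v h1
    exact ⟨z, hfix z hz, (mk_eq_mk_of_lie_eq hb hψ hvz).symm⟩

end Actions

end CoisotropicAction

end

theorem mainTheorem6 {E : Type*} [NormedAddCommGroup E] [NormedSpace ℂ E]
    [FiniteDimensional ℂ E] [CompleteSpace E]
    {G : Type*} [TopologicalSpace G] [ChartedSpace E G] [Group G]
    [LieGroup 𝓘(ℂ, E) ω G] [T2Space G] [ConnectedSpace G]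
    [LieAlgebra.IsSimple ℂ (CoisotropicAction.LieAlg E G)]
    (O : Set (CoisotropicAction.LieDual E G))
    (hO : CoisotropicAction.IsMinimalNilpotentOrbit O) :
    CoisotropicAction.IsDiagonalCoisotropic O O ∧
      ∀ K : Subgroup G, CoisotropicAction.IsComplexSymmetricPair (E := E) K →
        CoisotropicAction.IsCoisotropicOnOrbit K O := by
  obtain ⟨b, ψ, hb, hnd, hτ, hψ, rfl⟩ := hO.exists_eq_image
  exact ⟨CoisotropicAction.isDiagonalCoisotropic_image hb hψ hnd hτ, fun K hK =>
    CoisotropicAction.isCoisotropicOnOrbit_image hb hψ hnd hτ hK⟩
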